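/- Let $\mathbb R_+=(0,\infty)$, $\mathbb R_-=(-\infty,0)$, let $P_\pm$ be the orthogonal projections of $L^2(\mathbb R,dx)$ onto $L^2(\mathbb R_\pm)$, and identify bounded functions with multiplication operators. Let $\mathrm{Conf}(\mathbb R)$ be the space of configurations (locally finite subsets $X\subset\mathbb R$), with the $\sigma$-algebra generated by the maps $X\mapsto\#(X\cap B)$, $B$ bounded Borel. Let $K:\mathbb R\times\mathbb R\to\mathbb C$ be a measurable kernel that is $J$-Hermitian: it is the integral kernel of a bounded linear operator on $L^2(\mathbb R)$, also denoted $K$, and $K(x,y)=\mathrm{sgn}(x)\,\mathrm{sgn}(y)\,\overline{K(y,x)}$ for all $x,y\neq0$. Assume: (1) The operators $P_+KP_+$ and $P_-KP_-$ are non-negative. For all bounded Borel sets $\Delta_1\subset\mathbb R_+$ and $\Delta_2\subset\mathbb R_-$ the operators $\chi_{\Delta_i}K\chi_{\Delta_i}$ ($i=1,2$) are of trace class and $\chi_{\Delta_2}K\chi_{\Delta_1}$ is Hilbert--Schmidt; as usual for locally trace class operators, the diagonal of the kernel is normalised so that $\operatorname{tr}(\chi_{\Delta_i}K\chi_{\Delta_i})=\int_{\Delta_i}K(x,x)\,dx$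 for all such $\Delta_i$. The operator $\widehat K=\mathrm{sgn}\cdot K+\chi_{\mathbb R_-}$ is an orthogonal projection on $L^2(\mathbb R)$. (2) $\int_{|x|\le R}K(x,x)\,dx<\infty$ for every $R>0$, and there are $M>0$ and a non-negative function $\Phi\in L^1(\mathbb R)$ with $\int_{|t|\ge R}\Phi(t)\,dt=O(R^{-1})$ as $R\to\infty$ such that $|K(x,y)|^2\le\Phi(x-y)$ whenever $|x|\ge M$ and $|y|\ge M$. Let $\mathbb P_K$ be the determinantal point process on $\mathbb R$ with correlation kernel $K$, i.e. the probability measure on $\mathrm{Conf}(\mathbb R)$ such that for every $k\ge1$ and all pairwise disjoint bounded Borel sets $D_1,\dots,D_k\subset\mathbb R$ $$\int\prod_{i=1}^k\#(X\cap D_i)\,\mathbb P_K(dX)=\int_{D_1\times\cdots\times D_k}\det\bigl(K(x_i,x_j)\bigr)_{i,j=1}^k\,dx_1\cdots dx_k .$$ Then for every bounded Borel set $B\subset\mathbb R$ there is a measurable function $N_B^{out}:\mathrm{Conf}(\mathbb R)\to\mathbb Z$ such that for $\mathbb P_K$-almost every $X$ $$\#(B\cap X\cap\mathbb R_+)-\#(B\cap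 X\cap\mathbb R_-)=N_B^{out}(X\setminus B).$$ -/

import Mathlib

open MeasureTheory Filter Asymptotics
open scoped ENNReal InnerProductSpace ComplexConjugate

noncomputable section

namespace BalancedRigidity

/-! ### Trace class and Hilbert–Schmidt operators -/

section Operators

variable {H : Type*} [NormedAddCommGroup H] [InnerProductSpace ℂ H] [CompleteSpace H]

/-- `A` is Hilbert–Schmidt: `∑ ‖A eᵢ‖² < ∞` in every orthonormal basis. (A Hilbert basis may
always be indexed by its own range, so index types `s : Set H` suffice, and at least one exists.) -/
def IsHilbertSchmidt (A : H →L[ℂ] H) : Prop :=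
  ∀ (s : Set H) (b : HilbertBasis s ℂ H), Summable fun i => ‖A (b i)‖ ^ 2

/-- `A` is trace class: `∑ ⟨eᵢ, |A| eᵢ⟩ < ∞` in every orthonormal basis, `|A| = (A* A)^{1/2}`. -/
def IsTraceClass (A : H →L[ℂ] H) : Prop :=
  ∀ (s : Set H) (b : HilbertBasis s ℂ H), Summable fun i => ⟪b i, CFC.abs A (b i)⟫_ℂ

/-- `A` has trace `a`: `∑ ⟨eᵢ, A eᵢ⟩ = a` in every orthonormal basis. -/
def HasTrace (A : H →L[ℂ] H) (a : ℂ) : Prop :=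
  ∀ (s : Set H) (b : HilbertBasis s ℂ H), HasSum (fun i => ⟪b i, A (b i)⟫_ℂ) a

end Operators

/-! ### Operators on `L²(ℝ, dx)` -/

/-- The complex Hilbert space `L²(ℝ, dx)`. -/
abbrev L2 : Type := Lp ℂ 2 (volume : Measure ℝ)

/-- The multiplication operator `g ↦ f g` by an essentially bounded function `f`. -/
def mulOp (f : ℝ → ℂ) (hf : MemLp f ∞ volume) : L2 →L[ℂ] L2 :=
  (ContinuousLinearMap.mul ℂ ℂ).holderL volume ∞ 2 2 (hf.toLp f)

lemma memLp_chi {Δ : Set ℝ} (hΔ : MeasurableSet Δ) :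
    MemLp (Δ.indicator (1 : ℝ → ℂ)) ∞ volume :=
  (memLp_top_const (1 : ℂ)).indicator hΔ

/-- The operator of multiplication by the indicator function `χ_Δ`. -/
def chi (Δ : Set ℝ) (hΔ : MeasurableSet Δ) : L2 →L[ℂ] L2 :=
  mulOp (Δ.indicator 1) (memLp_chi hΔ)

/-- The orthogonal projection `P₊` onto `L²(ℝ₊)`. -/
def Pplus : L2 →L[ℂ] L2 := chi (Set.Ioi 0) measurableSet_Ioi

/-- The orthogonal projection `P₋` onto `L²(ℝ₋)`. -/
def Pminus : L2 →L[ℂ] L2 := chi (Set.Iio 0) measurableSet_Iio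

/-- The operator `J = P₊ - P₋`, i.e. multiplication by the sign function. -/
def J : L2 →L[ℂ] L2 := Pplus - Pminus

/-- `T̂ = sgn · T + χ_{ℝ₋}`. -/
def hat (T : L2 →L[ℂ] L2) : L2 →L[ℂ] L2 := J ∘L T + Pminus

/-- `K` is an integral kernel of the bounded operator `T` on `L²(ℝ)`. -/
structure IsIntegralKernel (K : ℝ → ℝ → ℂ) (T : L2 →L[ℂ] L2) : Prop where
  measurable : Measurable (Function.uncurry K)
  apply_ae : ∀ f : L2, ∀ᵐ x, Integrable (fun y => K x y * f y) ∧ T f x = ∫ y, K x y * f y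

/-- `K` is a `J`-Hermitian kernel with associated bounded operator `T`. -/
structure IsJHermitianKernel (K : ℝ → ℝ → ℂ) (T : L2 →L[ℂ] L2) : Prop extends
    IsIntegralKernel K T where
  symm : ∀ x y : ℝ, x ≠ 0 → y ≠ 0 →
    K x y = ((Real.sign x : ℝ) : ℂ) * ((Real.sign y : ℝ) : ℂ) * conj (K y x)

/-- The usual meaning of the diagonal `K(x,x)` of the kernel of a locally trace class operator.
The diagonal is Lebesgue null in the plane, so it is not determined by the operator itself; it is
normalised by `tr (χ_Δ T χ_Δ) = ∫_Δ K(x,x) dx` for bounded Borel `Δ ⊆ ℝ₊` and `Δ ⊆ ℝ₋`. -/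
def IsTraceDiagonal (K : ℝ → ℝ → ℂ) (T : L2 →L[ℂ] L2) : Prop :=
  ∀ (Δ : Set ℝ) (hΔ : MeasurableSet Δ), Bornology.IsBounded Δ →
    (Δ ⊆ Set.Ioi 0 ∨ Δ ⊆ Set.Iio 0) →
    IntegrableOn (fun x => K x x) Δ ∧
      HasTrace (chi Δ hΔ ∘L T ∘L chi Δ hΔ) (∫ x in Δ, K x x)

/-- First condition: positivity and local trace class properties of the diagonal blocks, local
Hilbert–Schmidt property of the off-diagonal block, and `T̂` is an orthogonal projection. -/
structure Condition1 (T : L2 →L[ℂ] L2) : Prop where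
  pos_plus : (Pplus ∘L T ∘L Pplus).IsPositive
  pos_minus : (Pminus ∘L T ∘L Pminus).IsPositive
  traceClass : ∀ (Δ : Set ℝ) (hΔ : MeasurableSet Δ), Bornology.IsBounded Δ →
    (Δ ⊆ Set.Ioi 0 ∨ Δ ⊆ Set.Iio 0) → IsTraceClass (chi Δ hΔ ∘L T ∘L chi Δ hΔ)
  hilbertSchmidt : ∀ (Δ₁ Δ₂ : Set ℝ) (h₁ : MeasurableSet Δ₁) (h₂ : MeasurableSet Δ₂),
    Bornology.IsBounded Δ₁ → Bornology.IsBounded Δ₂ → Δ₁ ⊆ Set.Ioi 0 → Δ₂ ⊆ Set.Iio 0 →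
    IsHilbertSchmidt (chi Δ₂ h₂ ∘L T ∘L chi Δ₁ h₁)
  projection : IsStarProjection (hat T)

/-- Second condition: the diagonal is locally integrable on `ℝ`, and off-diagonal decay. -/
structure Condition2 (K : ℝ → ℝ → ℂ) (M : ℝ) : Prop where
  diag_integrable : ∀ R : ℝ, 0 < R → IntegrableOn (fun x => K x x) {x | |x| ≤ R}
  decay : ∃ Φ : ℝ → ℝ, (∀ t, 0 ≤ Φ t) ∧ Integrable Φ ∧
    (fun R : ℝ => ∫ t in {t | R ≤ |t|}, Φ t) =O[atTop] (fun R : ℝ => R⁻¹) ∧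
    ∀ x y : ℝ, M ≤ |x| → M ≤ |y| → ‖K x y‖ ^ 2 ≤ Φ (x - y)

/-! ### Configurations and determinantal point processes -/

/-- A (simple) configuration on `ℝ`: a locally finite subset. -/
structure Conf where
  carrier : Set ℝ
  locallyFinite : ∀ C : Set ℝ, IsCompact C → (carrier ∩ C).Finite

/-- `#_B (X) = #(X ∩ B)`, used for bounded `B` only (then `X ∩ B` is finite). -/
def count (B : Set ℝ) (X : Conf) : ℕ := (X.carrier ∩ B).ncard

/-- The Borel structure of `Conf(ℝ)`: generated by the counting functions `#_B`, `B` bounded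
Borel. -/
instance : MeasurableSpace Conf :=
  ⨆ (B : Set ℝ) (_ : MeasurableSet B) (_ : Bornology.IsBounded B),
    MeasurableSpace.comap (count B) ⊤

/-- The configuration `X ∖ B`. -/
def Conf.diff (X : Conf) (B : Set ℝ) : Conf where
  carrier := X.carrier \ B
  locallyFinite C hC := (X.locallyFinite C hC).subset
    (Set.inter_subset_inter_left _ Set.sdiff_subset)

/-- The point process `P` is determinantal with correlation kernel `K` (with respect to Lebesgue
measure): `E ∏ #(X ∩ Dᵢ) = ∫_{D₁ × ⋯ × D_k} det (K(xᵢ, xⱼ)) dx` for disjoint bounded `Dᵢ`. -/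
structure IsDeterminantal (K : ℝ → ℝ → ℂ) (P : Measure Conf) : Prop where
  isProbabilityMeasure : IsProbabilityMeasure P
  correlation : ∀ (k : ℕ), 1 ≤ k → ∀ D : Fin k → Set ℝ,
    (∀ i, MeasurableSet (D i)) → (∀ i, Bornology.IsBounded (D i)) →
    Pairwise (fun i j => Disjoint (D i) (D j)) →
    Integrable (fun X => ∏ i, (count (D i) X : ℝ)) P ∧
    IntegrableOn (fun x : Fin k → ℝ => (Matrix.of fun i j => K (x i) (x j)).det)
      (Set.univ.pi D) ∧
    ((∫ X, ∏ i, (count (D i) X : ℝ) ∂P : ℝ) : ℂ) =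
      ∫ x in Set.univ.pi D, (Matrix.of fun i j => K (x i) (x j)).det

end BalancedRigidity

end

namespace BalancedRigidity

/-! ### Multiplication by indicator and sign functions -/

/-! The proof follows the Ghosh–Peres scheme: find finitely supported weights `h n`, equal to 1 on
every cell meeting `B`, for which the signed linear statistic `∑ sgn(x) h(⌊x⌋)` has variance tending
to zero. Along a summable sequence of variances the centred statistics tend to 0 almost surely. The
points in `B` contribute exactly the balance of positive and negative points, so that balance is a
limit of quantities depending only on `X ∖ B`.

The signs enter through `K(x,y) K(y,x) = sgn(x) sgn(y) |K(x,y)|²`: they cancel against those of the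
statistic, and the variance is at most a quadratic form with diagonal part the mean numbers of
points in unit cells and with conductances `A i j = ∬ |K|²` over pairs of cells
(`variance_signedStat_le`). Since `hat T` is a projection, `∬_{ℝ×Δ} |K|² = ∫_Δ K(x,x) dx` for
one-sided `Δ` (`lintegral_kernel_sq`), so the means are the row sums of `A`. The form is then the
Dirichlet form `½ ∑ (h i - h j)² A i j`, with a Laplacian that kills constants
(`hasSum_form_laplacian`).

The tail `O(1/R)` of `Φ` is critical: trapezoidal cut-offs at scale `R` have bounded energy
(`form_cutoff_le`), but nothing forces it to be small. However, the cut-offs tend pointwise to 1, so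
by `tendsto_form_laplacian` they become orthogonal to every fixed weight. A Banach–Saks averaging of
sparse cut-offs (`exists_form_le`) divides the energy by the number of terms and preserves the value
1 near `B`. -/

lemma chi_coeFn {Δ : Set ℝ} (hΔ : MeasurableSet Δ) (f : L2) :
    (chi Δ hΔ f : ℝ → ℂ) =ᵐ[volume] Δ.indicator f := by
  have h := (ContinuousLinearMap.mul ℂ ℂ).coeFn_holder (r := 2) (μ := volume)
    ((memLp_chi hΔ).toLp _) f
  filter_upwards [h, (memLp_chi hΔ).coeFn_toLp] with x hx hx'
  refine hx.trans ?_
  rw [hx']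
  by_cases hxΔ : x ∈ Δ <;> simp [hxΔ]

lemma inner_chi_left {Δ : Set ℝ} (hΔ : MeasurableSet Δ) (f g : L2) :
    ⟪chi Δ hΔ f, g⟫_ℂ = ⟪f, chi Δ hΔ g⟫_ℂ := by
  rw [L2.inner_def, L2.inner_def]
  refine integral_congr_ae ?_
  filter_upwards [chi_coeFn hΔ f, chi_coeFn hΔ g] with x hf hg
  rw [hf, hg]
  by_cases hx : x ∈ Δ <;> simp [hx]

lemma chi_chi {Δ Δ' : Set ℝ} (hΔ : MeasurableSet Δ) (hΔ' : MeasurableSet Δ') (f : L2) :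
    chi Δ hΔ (chi Δ' hΔ' f) = chi (Δ ∩ Δ') (hΔ.inter hΔ') f := by
  refine Lp.ext ?_
  filter_upwards [chi_coeFn hΔ (chi Δ' hΔ' f), chi_coeFn hΔ' f,
    chi_coeFn (hΔ.inter hΔ') f] with x h1 h2 h3
  rw [h1, h3]
  by_cases hx : x ∈ Δ <;> by_cases hx' : x ∈ Δ' <;> simp [hx, hx', h2]

lemma chi_eq_of_eq {Δ Δ' : Set ℝ} (hΔ : MeasurableSet Δ) (hΔ' : MeasurableSet Δ') (h : Δ = Δ') :
    chi Δ hΔ = chi Δ' hΔ' := by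
  subst h; rfl

lemma chi_empty (f : L2) : chi ∅ MeasurableSet.empty f = 0 := by
  refine Lp.ext ?_
  filter_upwards [chi_coeFn MeasurableSet.empty f, Lp.coeFn_zero ℂ 2 (volume : Measure ℝ)]
    with x h1 h2
  rw [h1, h2]; simp

lemma chi_chi_of_subset {Δ Δ' : Set ℝ} (hΔ : MeasurableSet Δ) (hΔ' : MeasurableSet Δ')
    (h : Δ' ⊆ Δ) (f : L2) : chi Δ hΔ (chi Δ' hΔ' f) = chi Δ' hΔ' f := by
  rw [chi_chi, chi_eq_of_eq _ hΔ' (Set.inter_eq_right.2 h)]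

lemma chi_chi_of_disjoint {Δ Δ' : Set ℝ} (hΔ : MeasurableSet Δ) (hΔ' : MeasurableSet Δ')
    (h : Disjoint Δ Δ') (f : L2) : chi Δ hΔ (chi Δ' hΔ' f) = 0 := by
  rw [chi_chi, chi_eq_of_eq _ MeasurableSet.empty h.inter_eq, chi_empty]

lemma disjoint_Ioi_Iio : Disjoint (Set.Ioi (0 : ℝ)) (Set.Iio 0) :=
  Set.disjoint_left.2 fun _ hx hx' => lt_asymm (Set.mem_Ioi.1 hx) hx'

lemma inner_J_left (f g : L2) : ⟪J f, g⟫_ℂ = ⟪f, J g⟫_ℂ := by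
  simp only [J, Pplus, Pminus, sub_apply, inner_sub_left, inner_sub_right,
    inner_chi_left]

lemma J_J (f : L2) : J (J f) = f := by
  have key : J (J f) = Pplus f + Pminus f := by
    simp only [J, sub_apply, map_sub, Pplus, Pminus]
    rw [chi_chi_of_subset _ _ subset_rfl, chi_chi_of_subset _ _ subset_rfl,
      chi_chi_of_disjoint _ _ disjoint_Ioi_Iio, chi_chi_of_disjoint _ _ disjoint_Ioi_Iio.symm]
    abel
  rw [key]
  refine Lp.ext ?_
  have h0 : ∀ᵐ x : ℝ, x ≠ 0 := Measure.ae_ne volume 0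
  filter_upwards [Lp.coeFn_add (Pplus f) (Pminus f), chi_coeFn measurableSet_Ioi f,
    chi_coeFn measurableSet_Iio f, h0] with x h1 h2 h3 h4
  rw [h1, Pi.add_apply, Pplus, Pminus, h2, h3]
  rcases lt_or_gt_of_ne h4 with h | h
  · simp [h, not_lt.2 h.le]
  · simp [h, not_lt.2 h.le]

lemma norm_J (f : L2) : ‖J f‖ = ‖f‖ := by
  have h : ⟪J f, J f⟫_ℂ = ⟪f, f⟫_ℂ := by rw [inner_J_left, J_J]
  rw [inner_self_eq_norm_sq_to_K, inner_self_eq_norm_sq_to_K] at h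
  have h' : ‖J f‖ ^ 2 = ‖f‖ ^ 2 := by exact_mod_cast h
  exact (pow_left_inj₀ (norm_nonneg _) (norm_nonneg _) two_ne_zero).1 h'

/-- Since `hat T` is a projection, `χ_Δ T χ_Δ = (T χ_Δ)* (T χ_Δ)` for one-sided `Δ`. -/
lemma inner_compression_eq_norm_sq {T : L2 →L[ℂ] L2} (hT : IsStarProjection (hat T))
    {Δ : Set ℝ} (hΔ : MeasurableSet Δ) (hs : Δ ⊆ Set.Ioi 0 ∨ Δ ⊆ Set.Iio 0) (f : L2) :
    ⟪f, (chi Δ hΔ ∘L T ∘L chi Δ hΔ) f⟫_ℂ = ((‖T (chi Δ hΔ f)‖ ^ 2 : ℝ) : ℂ) := by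
  simp only [ContinuousLinearMap.comp_apply]
  rw [← inner_chi_left]
  set v := chi Δ hΔ f with hv
  have hproj : ⟪v, hat T v⟫_ℂ = ((‖hat T v‖ ^ 2 : ℝ) : ℂ) := by
    have h1 : hat T (hat T v) = hat T v := by
      have := hT.isIdempotentElem
      exact congrArg (fun A : L2 →L[ℂ] L2 => A v) this
    have h2 : ContinuousLinearMap.adjoint (hat T) = hat T := hT.isSelfAdjoint
    calc ⟪v, hat T v⟫_ℂ = ⟪v, hat T (hat T v)⟫_ℂ := by rw [h1]
      _ = ⟪hat T v, hat T v⟫_ℂ := by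
        rw [← ContinuousLinearMap.adjoint_inner_left, h2]
      _ = _ := by rw [inner_self_eq_norm_sq_to_K]; norm_cast
  have hhat : hat T v = J (T v) + Pminus v := rfl
  rcases hs with hs | hs
  · have hm : Pminus v = 0 :=
      chi_chi_of_disjoint _ _ (disjoint_Ioi_Iio.symm.mono_right hs) f
    have hp : Pplus v = v := chi_chi_of_subset _ _ hs f
    have hJ : J v = v := by simp [J, hm, hp]
    rw [hhat, hm, add_zero, norm_J, ← inner_J_left, hJ] at hproj
    exact hproj
  -- On the negative side `hat T v = J T v + v` and `J v = -v`. Expanding `⟪v, hat T v⟫ = ‖hat T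
  -- v‖²`, the terms `‖v‖²` and `⟪v, T v⟫` cancel and leave `⟪T v, v⟫ = ‖T v‖²`.
  · have hp : Pplus v = 0 :=
      chi_chi_of_disjoint _ _ (disjoint_Ioi_Iio.mono_right hs) f
    have hm : Pminus v = v := chi_chi_of_subset _ _ hs f
    have hJ : J v = -v := by simp [J, hm, hp]
    have e1 : ⟪v, J (T v)⟫_ℂ = -⟪v, T v⟫_ℂ := by rw [← inner_J_left, hJ, inner_neg_left]
    have e2 : ⟪J (T v), v⟫_ℂ = -⟪T v, v⟫_ℂ := by rw [inner_J_left, hJ, inner_neg_right]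
    have e3 : ((‖hat T v‖ ^ 2 : ℝ) : ℂ) = ⟪hat T v, hat T v⟫_ℂ := by
      rw [inner_self_eq_norm_sq_to_K]; norm_cast
    have e4 : ⟪J (T v), J (T v)⟫_ℂ = ((‖T v‖ ^ 2 : ℝ) : ℂ) := by
      rw [inner_self_eq_norm_sq_to_K, norm_J]; norm_cast
    rw [e3, hhat, hm, inner_add_right, inner_add_left, inner_add_right, inner_add_right,
      e1, e2, e4] at hproj
    have e5 : ⟪T v, v⟫_ℂ = ((‖T v‖ ^ 2 : ℝ) : ℂ) := by linear_combination hproj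
    rw [← inner_conj_symm, e5, Complex.conj_ofReal]

/-! ### The Hilbert–Schmidt norm of an integral operator -/

lemma lintegral_enorm_sq_coeFn (f : L2) :
    ∫⁻ x, ‖f x‖ₑ ^ 2 = ENNReal.ofReal (‖f‖ ^ 2) := by
  have h := eLpNorm_nnreal_pow_eq_lintegral (f := (f : ℝ → ℂ)) (μ := volume) (p := 2) two_ne_zero
  have h2 : eLpNorm f 2 volume = ENNReal.ofReal ‖f‖ := by
    rw [Lp.norm_def, ENNReal.ofReal_toReal (Lp.eLpNorm_ne_top f)]
  simp only [NNReal.coe_ofNat, ENNReal.coe_ofNat, ENNReal.rpow_ofNat] at h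
  rw [← h, h2, ENNReal.ofReal_pow (norm_nonneg _)]

/-- The diagonal integral of `K` over `Δ` is the sum of the `‖T χ_Δ bᵢ‖²`. -/
lemma hasSum_norm_sq {K : ℝ → ℝ → ℂ} {T : L2 →L[ℂ] L2} (hdiag : IsTraceDiagonal K T)
    (hT : IsStarProjection (hat T)) {Δ : Set ℝ} (hΔ : MeasurableSet Δ)
    (hb : Bornology.IsBounded Δ) (hs : Δ ⊆ Set.Ioi 0 ∨ Δ ⊆ Set.Iio 0)
    (s : Set L2) (b : HilbertBasis s ℂ L2) :
    HasSum (fun i => ‖T (chi Δ hΔ (b i))‖ ^ 2) (∫ x in Δ, K x x).re := by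
  have h := (hdiag Δ hΔ hb hs).2 s b
  simp only [inner_compression_eq_norm_sq hT hΔ hs] at h
  exact (Complex.hasSum_re h).congr_fun fun i => Complex.ofReal_re _

/-- The trace is computed in complete bases; any orthonormal family extends to one, and the terms
added are non-negative. -/
lemma sum_norm_sq_le {K : ℝ → ℝ → ℂ} {T : L2 →L[ℂ] L2} (hdiag : IsTraceDiagonal K T)
    (hT : IsStarProjection (hat T)) {Δ : Set ℝ} (hΔ : MeasurableSet Δ)
    (hb : Bornology.IsBounded Δ) (hs : Δ ⊆ Set.Ioi 0 ∨ Δ ⊆ Set.Iio 0)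
    {ι : Type*} {e : ι → L2} (he : Orthonormal ℂ e) (t : Finset ι) :
    ∑ i ∈ t, ‖T (chi Δ hΔ (e i))‖ ^ 2 ≤ (∫ x in Δ, K x x).re := by
  classical
  obtain ⟨w, b, hw, hbw⟩ := he.toSubtypeRange.exists_hilbertBasis_extension
  have hsum := hasSum_norm_sq hdiag hT hΔ hb hs w b
  rw [hbw] at hsum
  let φ : ι → w := fun i => ⟨e i, hw ⟨i, rfl⟩⟩
  have hφ : Function.Injective φ := fun i j hij =>
    he.linearIndependent.injective (congrArg Subtype.val hij)
  have := sum_le_hasSum (t.map ⟨φ, hφ⟩) (fun i _ => by positivity) hsum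
  simpa [φ] using this

lemma ae_apply_chi {K : ℝ → ℝ → ℂ} {T : L2 →L[ℂ] L2} (hK : IsIntegralKernel K T)
    {Δ : Set ℝ} (hΔ : MeasurableSet Δ) (f : L2) :
    ∀ᵐ x, T (chi Δ hΔ f) x = ∫ y, Δ.indicator (K x) y * f y := by
  filter_upwards [hK.apply_ae (chi Δ hΔ f)] with x hx
  rw [hx.2]
  refine integral_congr_ae ?_
  filter_upwards [chi_coeFn hΔ f] with y hy
  rw [hy]
  by_cases h : y ∈ Δ <;> simp [h]

/-- Testing the kernel on the indicator of `Δ` gives this. Square integrability of the rows is not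
yet known, but integrability is all that Lebesgue differentiation needs. -/
lemma ae_integrable_indicator {K : ℝ → ℝ → ℂ} {T : L2 →L[ℂ] L2} (hK : IsIntegralKernel K T)
    {Δ : Set ℝ} (hΔ : MeasurableSet Δ) (hb : Bornology.IsBounded Δ) :
    ∀ᵐ x, Integrable (Δ.indicator (K x)) := by
  have hfin : volume Δ ≠ ∞ := hb.measure_lt_top.ne
  filter_upwards [hK.apply_ae (indicatorConstLp 2 hΔ hfin (1 : ℂ))] with x hx
  refine hx.1.congr ?_
  filter_upwards [indicatorConstLp_coeFn (p := 2) (hs := hΔ) (hμs := hfin) (c := (1 : ℂ))]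
    with y hy
  rw [hy]
  by_cases h : y ∈ Δ <;> simp [h]

/-- Bessel's inequality for a square integrable function paired bilinearly with an orthonormal
family. -/
lemma tsum_enorm_integral_sq_le {k : ℝ → ℂ} (hk : AEStronglyMeasurable k volume)
    {ι : Type*} {e : ι → L2} (he : Orthonormal ℂ e) :
    ∑' i, ‖∫ y, k y * e i y‖ₑ ^ 2 ≤ ∫⁻ y, ‖k y‖ₑ ^ 2 := by
  by_cases htop : ∫⁻ y, ‖k y‖ₑ ^ 2 = ∞
  · rw [htop]; exact le_top
  -- Conjugation turns the bilinear pairing into an inner product, to which the usual Bessel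
  -- inequality applies.
  have hk' : MemLp (fun y => conj (k y)) 2 volume := by
    refine ⟨Complex.continuous_conj.comp_aestronglyMeasurable hk, ?_⟩
    have h := eLpNorm_nnreal_pow_eq_lintegral (f := fun y => conj (k y)) (μ := volume)
      (p := 2) two_ne_zero
    simp only [NNReal.coe_ofNat, ENNReal.coe_ofNat, ENNReal.rpow_ofNat, RCLike.enorm_conj] at h
    rw [← h] at htop
    by_contra hcon
    simp only [not_lt, top_le_iff] at hcon
    rw [hcon] at htop
    simp at htop
  set u : L2 := hk'.toLp _ with hu
  have hnorm : ∫⁻ y, ‖k y‖ₑ ^ 2 = ENNReal.ofReal (‖u‖ ^ 2) := by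
    rw [← lintegral_enorm_sq_coeFn]
    refine lintegral_congr_ae ?_
    filter_upwards [hk'.coeFn_toLp] with y hy
    rw [hy, RCLike.enorm_conj]
  have hin : ∀ i, ‖∫ y, k y * e i y‖ₑ ^ 2 = ENNReal.ofReal (‖⟪e i, u⟫_ℂ‖ ^ 2) := by
    intro i
    have : ∫ y, k y * e i y = ⟪u, e i⟫_ℂ := by
      rw [L2.inner_def]
      refine integral_congr_ae ?_
      filter_upwards [hk'.coeFn_toLp] with y hy
      rw [hy]; simp [mul_comm]
    rw [this, ← inner_conj_symm, RCLike.enorm_conj, ENNReal.ofReal_pow (norm_nonneg _),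
      ofReal_norm]
  simp_rw [hin]
  rw [hnorm, ENNReal.tsum_eq_iSup_sum]
  refine iSup_le fun s => ?_
  rw [← ENNReal.ofReal_sum_of_nonneg fun i _ => by positivity]
  exact ENNReal.ofReal_le_ofReal (he.sum_inner_products_le u)

/-- Write the trace as `∑ ‖T χ_Δ bᵢ‖²`, exchange sum and integral, and apply Bessel to almost every
row of the kernel. -/
lemma ofReal_diag_le_lintegral {K : ℝ → ℝ → ℂ} {T : L2 →L[ℂ] L2} (hK : IsIntegralKernel K T)
    (hdiag : IsTraceDiagonal K T)
    (hT : IsStarProjection (hat T)) {Δ : Set ℝ} (hΔ : MeasurableSet Δ)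
    (hb : Bornology.IsBounded Δ) (hs : Δ ⊆ Set.Ioi 0 ∨ Δ ⊆ Set.Iio 0) :
    ENNReal.ofReal (∫ x in Δ, K x x).re ≤ ∫⁻ x, ∫⁻ y in Δ, ‖K x y‖ₑ ^ 2 := by
  obtain ⟨w, b, -⟩ := exists_hilbertBasis ℂ L2
  have hsum := hasSum_norm_sq hdiag hT hΔ hb hs w b
  -- Only countably many terms are nonzero; this lets the almost-everywhere kernel formulas hold
  -- simultaneously and the sum be exchanged with the integral.
  set S := Function.support fun i => ‖T (chi Δ hΔ (b i))‖ ^ 2 with hS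
  have hScount : S.Countable := hsum.summable.countable_support
  have : Countable S := hScount.to_subtype
  have hmeas : ∀ x, Measurable (K x) := fun x => hK.measurable.of_uncurry_left
  have hae : ∀ᵐ x, ∀ i : S, T (chi Δ hΔ (b i)) x = ∫ y, Δ.indicator (K x) y * b i y :=
    ae_all_iff.2 fun i => ae_apply_chi hK hΔ (b i)
  have horth : Orthonormal ℂ fun i : S => b i :=
    b.orthonormal.comp _ Subtype.val_injective
  calc ENNReal.ofReal (∫ x in Δ, K x x).re
      = ∑' i : S, ENNReal.ofReal (‖T (chi Δ hΔ (b i))‖ ^ 2) := by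
        rw [← hsum.tsum_eq, ENNReal.ofReal_tsum_of_nonneg (fun _ => by positivity) hsum.summable]
        refine (tsum_subtype_eq_of_support_subset fun i hi => ?_).symm
        rw [hS, Function.mem_support]
        rintro h0
        exact hi (by simp only [h0, ENNReal.ofReal_zero])
    _ = ∑' i : S, ∫⁻ x, ‖T (chi Δ hΔ (b i)) x‖ₑ ^ 2 := by simp_rw [lintegral_enorm_sq_coeFn]
    _ = ∫⁻ x, ∑' i : S, ‖T (chi Δ hΔ (b i)) x‖ₑ ^ 2 := by
        rw [lintegral_tsum]
        intro i
        exact ((Lp.stronglyMeasurable _).measurable.enorm.pow_const 2).aemeasurable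
    _ ≤ ∫⁻ x, ∫⁻ y, ‖Δ.indicator (K x) y‖ₑ ^ 2 := by
        refine lintegral_mono_ae ?_
        filter_upwards [hae] with x hx
        simp_rw [hx]
        exact tsum_enorm_integral_sq_le ((hmeas x).indicator hΔ).aestronglyMeasurable horth
    _ = _ := by
        refine lintegral_congr fun x => ?_
        rw [← lintegral_indicator hΔ]
        refine lintegral_congr fun y => ?_
        by_cases h : y ∈ Δ <;> simp [h]

/-! ### Averages over cells of width `δ` and the upper bound for the Hilbert–Schmidt norm. -/

/-- The cell `[jδ, (j+1)δ)`. -/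
def cell (δ : ℝ) (j : ℤ) : Set ℝ := Set.Ico (j * δ) ((j + 1) * δ)

lemma measurableSet_cell (δ : ℝ) (j : ℤ) : MeasurableSet (cell δ j) := measurableSet_Ico

lemma mem_cell_iff {δ : ℝ} (hδ : 0 < δ) {j : ℤ} {y : ℝ} : y ∈ cell δ j ↔ ⌊y / δ⌋ = j := by
  rw [Int.floor_eq_iff, cell, Set.mem_Ico, le_div_iff₀ hδ, div_lt_iff₀ hδ]

lemma volume_cell (δ : ℝ) (j : ℤ) : volume (cell δ j) = ENNReal.ofReal δ := by
  rw [cell, Real.volume_Ico]; ring_nf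

lemma pairwise_disjoint_cell {δ : ℝ} (hδ : 0 < δ) : Pairwise (Function.onFun Disjoint (cell δ)) := by
  intro i j hij
  refine Set.disjoint_left.2 fun y hi hj => hij ?_
  rw [← (mem_cell_iff hδ).1 hi, ← (mem_cell_iff hδ).1 hj]

/-- The normalised indicator function of a cell. -/
noncomputable def cellFun (δ : ℝ) (j : ℤ) : L2 :=
  indicatorConstLp 2 (measurableSet_cell δ j) (by rw [volume_cell]; exact ENNReal.ofReal_ne_top)
    (((√δ)⁻¹ : ℝ) : ℂ)

lemma orthonormal_cellFun {δ : ℝ} (hδ : 0 < δ) : Orthonormal ℂ (cellFun δ) := by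
  rw [orthonormal_iff_ite]
  intro i j
  have hv : ∀ j, volume.real (cell δ j) = δ := fun j => by
    rw [Measure.real, volume_cell, ENNReal.toReal_ofReal hδ.le]
  rw [cellFun, L2.inner_indicatorConstLp_eq_inner_setIntegral,
    setIntegral_congr_ae (g := fun x => (cell δ j).indicator (fun _ => (((√δ)⁻¹ : ℝ) : ℂ)) x)
      (measurableSet_cell δ i) (by
        filter_upwards [indicatorConstLp_coeFn (p := 2) (hs := measurableSet_cell δ j)
          (hμs := by rw [volume_cell]; exact ENNReal.ofReal_ne_top)
          (c := (((√δ)⁻¹ : ℝ) : ℂ))] with x hx _ using hx),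
    setIntegral_indicator (measurableSet_cell δ j)]
  split_ifs with h
  · subst h
    rw [Set.inter_self, setIntegral_const, hv]
    have : δ * ((√δ)⁻¹ * (√δ)⁻¹) = 1 := by
      rw [← mul_inv, Real.mul_self_sqrt hδ.le, mul_inv_cancel₀ hδ.ne']
    simp only [Complex.real_smul, RCLike.inner_apply, Complex.conj_ofReal]
    rw [mul_assoc]
    exact_mod_cast this
  · rw [(pairwise_disjoint_cell hδ h).inter_eq]; simp

lemma integral_mul_cellFun {k : ℝ → ℂ} (δ : ℝ) (j : ℤ) :
    ∫ y, k y * cellFun δ j y = (∫ y in cell δ j, k y) * (((√δ)⁻¹ : ℝ) : ℂ) := by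
  rw [← integral_mul_const, ← integral_indicator (measurableSet_cell δ j)]
  refine integral_congr_ae ?_
  filter_upwards [indicatorConstLp_coeFn (p := 2) (hs := measurableSet_cell δ j)
    (hμs := by rw [volume_cell]; exact ENNReal.ofReal_ne_top)
    (c := (((√δ)⁻¹ : ℝ) : ℂ))] with y hy
  rw [cellFun, hy]
  by_cases h : y ∈ cell δ j <;> simp [h]

/-- The cellwise average of `k`. -/
noncomputable def cellAvg (k : ℝ → ℂ) (δ : ℝ) (y : ℝ) : ℂ := ⨍ z in cell δ ⌊y / δ⌋, k z

lemma measurable_cellAvg (k : ℝ → ℂ) (δ : ℝ) : Measurable (cellAvg k δ) :=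
  (measurable_from_top (f := fun j : ℤ => ⨍ z in cell δ j, k z)).comp
    (Int.measurable_floor.comp (measurable_id.div_const δ))

/-- Parseval's identity for the projection onto cellwise constant functions, in `ℝ≥0∞` so that `k`
need not be square integrable. -/
lemma lintegral_cellAvg_sq {k : ℝ → ℂ} {δ : ℝ} (hδ : 0 < δ) :
    ∫⁻ y, ‖cellAvg k δ y‖ₑ ^ 2 = ∑' j, ‖∫ y, k y * cellFun δ j y‖ₑ ^ 2 := by
  have hU : ⋃ j, cell δ j = Set.univ :=
    Set.eq_univ_of_forall fun y => Set.mem_iUnion.2 ⟨⌊y / δ⌋, (mem_cell_iff hδ).2 rfl⟩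
  rw [← setLIntegral_univ, ← hU,
    lintegral_iUnion (measurableSet_cell δ) (pairwise_disjoint_cell hδ)]
  congr 1; ext1 j
  rw [setLIntegral_congr_fun (g := fun _ => ‖⨍ z in cell δ j, k z‖ₑ ^ 2) (measurableSet_cell δ j)
    (fun y hy => by simp only [cellAvg, (mem_cell_iff hδ).1 hy]), setLIntegral_const, volume_cell,
    integral_mul_cellFun, setAverage_eq, Measure.real, volume_cell, ENNReal.toReal_ofReal hδ.le]
  rw [← ofReal_norm, ← ofReal_norm, ← ENNReal.ofReal_pow (norm_nonneg _),
    ← ENNReal.ofReal_pow (norm_nonneg _), ← ENNReal.ofReal_mul (by positivity)]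
  congr 1
  rw [norm_smul, norm_mul, Complex.norm_real, mul_pow, mul_pow, norm_inv, norm_inv, inv_pow,
    inv_pow, Real.norm_eq_abs, Real.norm_eq_abs, sq_abs, sq_abs, Real.sq_sqrt hδ.le]
  field_simp

/-- Lebesgue differentiation. Up to a null set the cell containing `y` is a closed ball, not centred
at `y`, so the version for balls with moving centres is used. -/
lemma ae_tendsto_cellAvg {k : ℝ → ℂ} (hk : Integrable k) :
    ∀ᵐ y, Tendsto (fun n : ℕ => cellAvg k (1 / ((n : ℝ) + 1)) y) atTop (nhds (k y)) := by
  filter_upwards [IsUnifLocDoublingMeasure.ae_tendsto_average (μ := volume)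
    hk.locallyIntegrable 1] with y hy
  have hδ : ∀ n : ℕ, 0 < 1 / ((n : ℝ) + 1) := fun n => by positivity
  have hball : ∀ (δ : ℝ) (j : ℤ),
      Metric.closedBall (((j : ℝ) + 1 / 2) * δ) (δ / 2) = Set.Icc (j * δ) ((j + 1) * δ) := by
    intro δ j; rw [Real.closedBall_eq_Icc]; congr 1 <;> ring
  have := hy (l := atTop) (fun n : ℕ => ((⌊y / (1 / ((n : ℝ) + 1))⌋ : ℝ) + 1 / 2) * (1 / ((n : ℝ) + 1)))
    (fun n : ℕ => (1 / ((n : ℝ) + 1)) / 2) ?_ ?_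
  · refine this.congr fun n => ?_
    simp only [hball, cellAvg]
    rw [setAverage_eq, setAverage_eq, cell]
    rw [setIntegral_congr_set Ico_ae_eq_Icc, measureReal_congr Ico_ae_eq_Icc]
  · refine tendsto_nhdsWithin_iff.2 ⟨?_, Eventually.of_forall fun n => ?_⟩
    · simpa using (tendsto_one_div_add_atTop_nhds_zero_nat (𝕜 := ℝ)).div_const 2
    · exact Set.mem_Ioi.2 (half_pos (hδ n))
  · refine Eventually.of_forall fun n => ?_
    rw [one_mul, hball]
    exact Set.Ico_subset_Icc_self ((mem_cell_iff (hδ n)).2 rfl)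

/-- For each mesh the cell functions are orthonormal, so the trace bounds the squared norm of the
cell-averaged kernel. Fatou, first in `y` and then in `x`, passes to the limit of vanishing mesh. -/
lemma lintegral_le_ofReal_diag {K : ℝ → ℝ → ℂ} {T : L2 →L[ℂ] L2} (hK : IsIntegralKernel K T)
    (hdiag : IsTraceDiagonal K T)
    (hT : IsStarProjection (hat T)) {Δ : Set ℝ} (hΔ : MeasurableSet Δ)
    (hb : Bornology.IsBounded Δ) (hs : Δ ⊆ Set.Ioi 0 ∨ Δ ⊆ Set.Iio 0) :
    ∫⁻ x, ∫⁻ y in Δ, ‖K x y‖ₑ ^ 2 ≤ ENNReal.ofReal (∫ x in Δ, K x x).re := by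
  let δ : ℕ → ℝ := fun n => 1 / ((n : ℝ) + 1)
  have hδ : ∀ n : ℕ, 0 < δ n := fun n => by positivity
  have hae : ∀ᵐ x, ∀ n j, T (chi Δ hΔ (cellFun (δ n) j)) x =
      ∫ y, Δ.indicator (K x) y * cellFun (δ n) j y :=
    ae_all_iff.2 fun n => ae_all_iff.2 fun j => ae_apply_chi hK hΔ _
  have hm : ∀ n j, Measurable fun x => ‖T (chi Δ hΔ (cellFun (δ n) j)) x‖ₑ ^ 2 := fun n j =>
    (Lp.stronglyMeasurable _).measurable.enorm.pow_const 2
  have hrow : ∀ᵐ x, ∫⁻ y in Δ, ‖K x y‖ₑ ^ 2 ≤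
      liminf (fun n => ∑' j, ‖T (chi Δ hΔ (cellFun (δ n) j)) x‖ₑ ^ 2) atTop := by
    filter_upwards [hae, ae_integrable_indicator hK hΔ hb] with x hx hint
    simp_rw [hx, ← lintegral_cellAvg_sq (hδ _)]
    refine le_trans (le_of_eq ?_)
      (lintegral_liminf_le fun n => (measurable_cellAvg _ _).enorm.pow_const 2)
    rw [← lintegral_indicator hΔ]
    refine lintegral_congr_ae ?_
    filter_upwards [ae_tendsto_cellAvg hint] with y hy
    have h2 : Tendsto (fun n : ℕ => ‖cellAvg (Δ.indicator (K x)) (δ n) y‖ₑ ^ 2) atTop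
        (nhds (‖Δ.indicator (K x) y‖ₑ ^ 2)) := ((ENNReal.continuous_pow 2).tendsto _).comp hy.enorm
    rw [h2.liminf_eq]
    by_cases h : y ∈ Δ <;> simp [h]
  have hbound : ∀ n, ∫⁻ x, ∑' j, ‖T (chi Δ hΔ (cellFun (δ n) j)) x‖ₑ ^ 2 ≤
      ENNReal.ofReal (∫ x in Δ, K x x).re := by
    intro n
    rw [lintegral_tsum fun j => (hm n j).aemeasurable]
    simp_rw [lintegral_enorm_sq_coeFn]
    rw [ENNReal.tsum_eq_iSup_sum]
    refine iSup_le fun s => ?_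
    rw [← ENNReal.ofReal_sum_of_nonneg fun i _ => by positivity]
    exact ENNReal.ofReal_le_ofReal
      (sum_norm_sq_le hdiag hT hΔ hb hs (orthonormal_cellFun (hδ n)) s)
  calc ∫⁻ x, ∫⁻ y in Δ, ‖K x y‖ₑ ^ 2
      ≤ ∫⁻ x, liminf (fun n => ∑' j, ‖T (chi Δ hΔ (cellFun (δ n) j)) x‖ₑ ^ 2) atTop :=
        lintegral_mono_ae hrow
    _ ≤ liminf (fun n => ∫⁻ x, ∑' j, ‖T (chi Δ hΔ (cellFun (δ n) j)) x‖ₑ ^ 2) atTop :=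
        lintegral_liminf_le fun n => Measurable.tsum fun j => hm n j
    _ ≤ liminf (fun _ : ℕ => ENNReal.ofReal (∫ x in Δ, K x x).re) atTop :=
        liminf_le_liminf (Eventually.of_forall hbound)
    _ = _ := liminf_const _

/-- The squared Hilbert–Schmidt norm of `T χ_Δ` is the diagonal integral over `Δ`. -/
lemma lintegral_kernel_sq {K : ℝ → ℝ → ℂ} {T : L2 →L[ℂ] L2} (hK : IsIntegralKernel K T)
    (hdiag : IsTraceDiagonal K T)
    (hT : IsStarProjection (hat T)) {Δ : Set ℝ} (hΔ : MeasurableSet Δ)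
    (hb : Bornology.IsBounded Δ) (hs : Δ ⊆ Set.Ioi 0 ∨ Δ ⊆ Set.Iio 0) :
    ∫⁻ x, ∫⁻ y in Δ, ‖K x y‖ₑ ^ 2 = ENNReal.ofReal (∫ x in Δ, K x x).re :=
  (lintegral_le_ofReal_diag hK hdiag hT hΔ hb hs).antisymm
    (ofReal_diag_le_lintegral hK hdiag hT hΔ hb hs)

/-! ### Counting functions -/

lemma measurable_count {B : Set ℝ} (hB : MeasurableSet B) (hb : Bornology.IsBounded B) :
    Measurable (count B) := by
  intro s _
  have h : MeasurableSpace.comap (count B) ⊤ ≤ (inferInstance : MeasurableSpace Conf) :=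
    le_iSup_of_le B (le_iSup_of_le hB (le_iSup_of_le hb le_rfl))
  exact h _ ⟨s, trivial, rfl⟩

lemma finite_inter (X : Conf) {D : Set ℝ} (hD : Bornology.IsBounded D) :
    (X.carrier ∩ D).Finite := by
  obtain ⟨r, hr⟩ := hD.subset_closedBall 0
  exact (X.locallyFinite _ (isCompact_closedBall 0 r)).subset (Set.inter_subset_inter_right _ hr)

lemma count_eq_sum_fiber {ι : Type*} (X : Conf) {D : Set ℝ} (hD : Bornology.IsBounded D)
    (f : ℝ → ι) (t : Finset ι) (ht : ∀ y ∈ D, f y ∈ t) :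
    count D X = ∑ j ∈ t, count (D ∩ f ⁻¹' {j}) X := by
  classical
  have hfin := finite_inter X hD
  have e : count D X = hfin.toFinset.card := by rw [count, Set.ncard_eq_toFinset_card _ hfin]
  rw [e, Finset.card_eq_sum_card_fiberwise (f := f) (t := t)]
  · refine Finset.sum_congr rfl fun j _ => ?_
    rw [count, ← Set.ncard_coe_finset]
    congr 1
    ext y
    simp only [Set.mem_inter_iff, Set.mem_preimage, Set.mem_singleton_iff, Finset.coe_filter,
      Set.Finite.mem_toFinset, Set.mem_ofPred_eq]
    tauto
  · intro y hy
    exact ht y (by simpa using (by simpa using hy : y ∈ X.carrier ∧ y ∈ D).2)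

lemma floor_mem_Icc {D : Set ℝ} (hD : Bornology.IsBounded D) {c : ℝ} (hc : 0 ≤ c) :
    ∃ t : Finset ℤ, ∀ y ∈ D, ⌊y * c⌋ ∈ t := by
  obtain ⟨r, hr⟩ := hD.subset_closedBall 0
  refine ⟨Finset.Icc ⌊-r * c⌋ ⌊r * c⌋, fun y hy => ?_⟩
  have := hr hy
  rw [Metric.mem_closedBall, dist_zero_right, Real.norm_eq_abs, abs_le] at this
  exact Finset.mem_Icc.2 ⟨Int.floor_mono (by gcongr; exact this.1),
    Int.floor_mono (by gcongr; exact this.2)⟩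

lemma eventually_floor_ne {x y : ℝ} (h : x ≠ y) :
    ∀ᶠ n : ℕ in atTop, ⌊x * n⌋ ≠ ⌊y * n⌋ := by
  have hpos : 0 < |x - y| := abs_pos.2 (sub_ne_zero.2 h)
  filter_upwards [(tendsto_natCast_atTop_atTop (R := ℝ)).eventually_ge_atTop (1 / |x - y|)]
    with n hn heq
  have h1 := Int.abs_sub_lt_one_of_floor_eq_floor heq
  rw [← sub_mul, abs_mul, Nat.abs_cast] at h1
  rw [div_le_iff₀ hpos, mul_comm] at hn
  linarith

/-! ### Second moments of the counting functions -/

/-- The set `D` lies on one side of the origin, where the sign is `s`. -/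
structure Sided (s : ℝ) (D : Set ℝ) : Prop where
  sq_eq_one : s ^ 2 = 1
  sign_eq : ∀ x ∈ D, Real.sign x = s

lemma Sided.ne_zero {s : ℝ} {D : Set ℝ} (h : Sided s D) {x : ℝ} (hx : x ∈ D) : x ≠ 0 := by
  rintro rfl
  have h1 := h.sign_eq 0 hx
  have h2 := h.sq_eq_one
  rw [← h1] at h2
  simp at h2

lemma Sided.mono {s : ℝ} {D D' : Set ℝ} (h : Sided s D) (hD : D' ⊆ D) : Sided s D' :=
  ⟨h.sq_eq_one, fun x hx => h.sign_eq x (hD hx)⟩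

lemma Sided.subset_or {s : ℝ} {D : Set ℝ} (h : Sided s D) :
    D ⊆ Set.Ioi 0 ∨ D ⊆ Set.Iio 0 := by
  have key : ∀ x ∈ D, 0 < s * x := fun x hx => by
    rw [← h.sign_eq x hx]; exact Real.sign_mul_pos_of_ne_zero x (h.ne_zero hx)
  rcases sq_eq_one_iff.1 h.sq_eq_one with rfl | rfl
  · exact Or.inl fun x hx => by simpa using key x hx
  · exact Or.inr fun x hx => by simpa using key x hx

/-- `∫∫_{D × D'} |K(x,y)|² dx dy`. -/
noncomputable def energy (K : ℝ → ℝ → ℂ) (D D' : Set ℝ) : ℝ := ∫ p in D ×ˢ D', ‖K p.1 p.2‖ ^ 2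

section

variable {K : ℝ → ℝ → ℂ} {T : L2 →L[ℂ] L2} {P : Measure Conf}

lemma IsJHermitianKernel.norm_symm (hK : IsJHermitianKernel K T) {x y : ℝ} (hx : x ≠ 0)
    (hy : y ≠ 0) : ‖K x y‖ = ‖K y x‖ := by
  rw [hK.symm x y hx hy]
  rcases Real.sign_apply_eq_of_ne_zero x hx with h | h <;>
  rcases Real.sign_apply_eq_of_ne_zero y hy with h' | h' <;> simp [h, h']

/-- This is where `J`-Hermitian symmetry departs from the Hermitian case: points on opposite sides
of the origin are positively correlated. -/
lemma IsJHermitianKernel.mul_swap (hK : IsJHermitianKernel K T) {s s' : ℝ} {D D' : Set ℝ}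
    (hs : Sided s D) (hs' : Sided s' D') {x y : ℝ} (hx : x ∈ D) (hy : y ∈ D') :
    K x y * K y x = ((s * s' * ‖K x y‖ ^ 2 : ℝ) : ℂ) := by
  have h1 := hK.symm y x (hs'.ne_zero hy) (hs.ne_zero hx)
  rw [hs.sign_eq x hx, hs'.sign_eq y hy] at h1
  rw [h1]
  have : K x y * (s' * s * conj (K x y)) = s * s' * (K x y * conj (K x y)) := by ring
  rw [this, Complex.mul_conj, Complex.normSq_eq_norm_sq]
  push_cast; ring

lemma integral_count (hP : IsDeterminantal K P) {D : Set ℝ} (hD : MeasurableSet D)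
    (hb : Bornology.IsBounded D) :
    Integrable (fun X => (count D X : ℝ)) P ∧
      ((∫ X, (count D X : ℝ) ∂P : ℝ) : ℂ) = ∫ x in D, K x x := by
  obtain ⟨h1, -, h3⟩ := hP.correlation 1 le_rfl (fun _ => D) (fun _ => hD) (fun _ => hb)
    (fun i j hij => (hij (Subsingleton.elim _ _)).elim)
  simp only [Fin.prod_univ_one, Matrix.det_fin_one, Matrix.of_apply] at h1 h3
  refine ⟨h1, h3.trans ?_⟩
  rw [← (volume_preserving_funUnique (Fin 1) ℝ).setIntegral_preimage_emb
    (MeasurableEquiv.measurableEmbedding _) (fun x => K x x) D]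
  have : (MeasurableEquiv.funUnique (Fin 1) ℝ) ⁻¹' D = Set.univ.pi fun _ => D := by
    ext x; simp
  rw [this]
  rfl

lemma integrableOn_kernel_sq (hK : IsJHermitianKernel K T) (hdiag : IsTraceDiagonal K T)
    (hT : IsStarProjection (hat T)) {s : ℝ} {D D' : Set ℝ}
    (hD' : MeasurableSet D') (hb' : Bornology.IsBounded D') (hs' : Sided s D') :
    IntegrableOn (fun p : ℝ × ℝ => ‖K p.1 p.2‖ ^ 2) (D ×ˢ D') := by
  have hm : Measurable fun p : ℝ × ℝ => ‖K p.1 p.2‖ ^ 2 := hK.measurable.norm.pow_const 2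
  have hU : IntegrableOn (fun p : ℝ × ℝ => ‖K p.1 p.2‖ ^ 2) (Set.univ ×ˢ D') := by
    refine ⟨hm.aestronglyMeasurable, ?_⟩
    rw [HasFiniteIntegral, Measure.volume_eq_prod, ← Measure.prod_restrict,
      lintegral_prod _ hm.enorm.aemeasurable, Measure.restrict_univ]
    simp only [enorm_pow, enorm_norm]
    rw [lintegral_kernel_sq hK.toIsIntegralKernel hdiag hT hD' hb' hs'.subset_or]
    exact ENNReal.ofReal_lt_top
  exact hU.mono_set (Set.prod_mono_left (Set.subset_univ _))

lemma ofReal_energy (hK : IsJHermitianKernel K T) (hdiag : IsTraceDiagonal K T)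
    (hT : IsStarProjection (hat T)) {s : ℝ} {D D' : Set ℝ}
    (hD' : MeasurableSet D') (hb' : Bornology.IsBounded D') (hs' : Sided s D') :
    ENNReal.ofReal (energy K D D') = ∫⁻ x in D, ∫⁻ y in D', ‖K x y‖ₑ ^ 2 := by
  have hm : Measurable fun p : ℝ × ℝ => ‖K p.1 p.2‖ ^ 2 := hK.measurable.norm.pow_const 2
  rw [energy, ofReal_integral_eq_lintegral_ofReal
    (integrableOn_kernel_sq hK hdiag hT hD' hb' hs') (Eventually.of_forall fun _ => by positivity)]
  rw [Measure.volume_eq_prod, ← Measure.prod_restrict, lintegral_prod _ hm.ennreal_ofReal.aemeasurable]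
  simp only [ENNReal.ofReal_pow (norm_nonneg _), ofReal_norm]

/-- In the two-point determinant the diagonal product factors into the two means, and `mul_swap`
evaluates the other product. -/
lemma integral_count_mul (hK : IsJHermitianKernel K T) (hdiag : IsTraceDiagonal K T)
    (hT : IsStarProjection (hat T)) (hP : IsDeterminantal K P) {s s' : ℝ} {D D' : Set ℝ}
    (hD : MeasurableSet D) (hb : Bornology.IsBounded D) (hs : Sided s D)
    (hD' : MeasurableSet D') (hb' : Bornology.IsBounded D') (hs' : Sided s' D')
    (hdisj : Disjoint D D') :
    Integrable (fun X => (count D X : ℝ) * count D' X) P ∧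
      ∫ X, (count D X : ℝ) * count D' X ∂P =
        (∫ X, (count D X : ℝ) ∂P) * (∫ X, (count D' X : ℝ) ∂P) - s * s' * energy K D D' := by
  obtain ⟨h1, -, h3⟩ := hP.correlation 2 one_le_two ![D, D'] (by simp [Fin.forall_fin_two, hD, hD'])
    (by simp [Fin.forall_fin_two, hb, hb']) (by
      intro i j hij
      fin_cases i <;> fin_cases j <;> first | exact (hij rfl).elim | skip
      · exact hdisj
      · exact hdisj.symm)
  simp only [Fin.prod_univ_two, Matrix.det_fin_two, Matrix.of_apply, Matrix.cons_val_zero,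
    Matrix.cons_val_one] at h1 h3
  refine ⟨h1, ?_⟩
  have hpre : (MeasurableEquiv.finTwoArrow (α := ℝ)) ⁻¹' (D ×ˢ D') = Set.univ.pi ![D, D'] := by
    ext x; simp [Fin.forall_fin_two]
  have h4 : ∫ x in Set.univ.pi ![D, D'], (K (x 0) (x 0) * K (x 1) (x 1) - K (x 0) (x 1) * K (x 1) (x 0))
      = ∫ p in D ×ˢ D', (K p.1 p.1 * K p.2 p.2 - K p.1 p.2 * K p.2 p.1) := by
    rw [← (volume_preserving_finTwoArrow ℝ).setIntegral_preimage_emb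
      (MeasurableEquiv.measurableEmbedding _), hpre]
    rfl
  have hI : IntegrableOn (fun p : ℝ × ℝ => K p.1 p.1 * K p.2 p.2) (D ×ˢ D') := by
    rw [IntegrableOn, Measure.volume_eq_prod, ← Measure.prod_restrict]
    exact (hdiag D hD hb hs.subset_or).1.mul_prod (hdiag D' hD' hb' hs'.subset_or).1
  have hA := integrableOn_kernel_sq (D := D) hK hdiag hT hD' hb' hs'
  have h5 : ∫ p in D ×ˢ D', (K p.1 p.1 * K p.2 p.2 - K p.1 p.2 * K p.2 p.1) =
      ∫ p in D ×ˢ D', (K p.1 p.1 * K p.2 p.2 - ((s * s' * ‖K p.1 p.2‖ ^ 2 : ℝ) : ℂ)) :=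
    setIntegral_congr_fun (hD.prod hD') fun p hp => by
      simp only [hK.mul_swap hs hs' hp.1 hp.2]
  have hB : IntegrableOn (fun p : ℝ × ℝ => ((s * s' * ‖K p.1 p.2‖ ^ 2 : ℝ) : ℂ)) (D ×ˢ D') :=
    (hA.const_mul (s * s')).ofReal
  rw [h4, h5, integral_sub hI hB, integral_complex_ofReal,
    integral_const_mul, Measure.volume_eq_prod,
    setIntegral_prod_mul (fun x => K x x) (fun y => K y y), ← Measure.volume_eq_prod,
    ← (integral_count hP hD hb).2, ← (integral_count hP hD' hb').2] at h3
  exact_mod_cast h3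

/-- The diagonal is null and cells of width `1/n` eventually separate any two distinct points;
dominated convergence does the rest. -/
lemma tendsto_energy_offDiag (hK : IsJHermitianKernel K T) (hdiag : IsTraceDiagonal K T)
    (hT : IsStarProjection (hat T)) {s : ℝ} {D : Set ℝ}
    (hD : MeasurableSet D) (hb : Bornology.IsBounded D) (hs : Sided s D) :
    Tendsto (fun n : ℕ => ∫ p in D ×ˢ D ∩ {p | ⌊p.1 * n⌋ ≠ ⌊p.2 * n⌋}, ‖K p.1 p.2‖ ^ 2) atTop
      (nhds (energy K D D)) := by
  have hint := integrableOn_kernel_sq (D := D) hK hdiag hT hD hb hs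
  have hm : Measurable fun p : ℝ × ℝ => ‖K p.1 p.2‖ ^ 2 := hK.measurable.norm.pow_const 2
  have hset : ∀ n : ℕ, MeasurableSet {p : ℝ × ℝ | ⌊p.1 * n⌋ ≠ ⌊p.2 * n⌋} := fun n =>
    (measurableSet_eq_fun (Int.measurable_floor.comp (measurable_fst.mul_const _))
      (Int.measurable_floor.comp (measurable_snd.mul_const _))).compl
  have hne : ∀ᵐ p : ℝ × ℝ, p.1 ≠ p.2 := by
    have : MeasurableSet {p : ℝ × ℝ | p.1 ≠ p.2} :=
      (measurableSet_eq_fun measurable_fst measurable_snd).compl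
    rw [Measure.volume_eq_prod, Measure.ae_prod_iff_ae_ae this]
    refine Eventually.of_forall fun x => ?_
    filter_upwards [Measure.ae_ne volume x] with y hy using hy.symm
  simp_rw [← setIntegral_indicator (hset _)]
  refine tendsto_integral_of_dominated_convergence (fun p => ‖K p.1 p.2‖ ^ 2)
    (fun n => (hm.indicator (hset n)).aestronglyMeasurable) hint
    (fun n => Eventually.of_forall fun p => ?_) ?_
  · refine (norm_indicator_le_norm_self _ _).trans (le_of_eq ?_)
    simp
  · filter_upwards [ae_restrict_of_ae hne] with p hp
    refine tendsto_const_nhds.congr' ?_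
    filter_upwards [eventually_floor_ne hp] with n hn
    rw [Set.indicator_of_mem]
    exact hn

/-- The second moment of a counting function, computed along partitions into small cells. -/
lemma integral_count_sq_le (hK : IsJHermitianKernel K T) (hdiag : IsTraceDiagonal K T)
    (hT : IsStarProjection (hat T)) (hP : IsDeterminantal K P) {s : ℝ} {D : Set ℝ}
    (hD : MeasurableSet D) (hb : Bornology.IsBounded D) (hs : Sided s D) :
    Integrable (fun X => (count D X : ℝ) ^ 2) P ∧
      ∫ X, (count D X : ℝ) ^ 2 ∂P ≤
        (∫ X, (count D X : ℝ) ∂P) + (∫ X, (count D X : ℝ) ∂P) ^ 2 - energy K D D := by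
  classical
  set ρ := ∫ X, (count D X : ℝ) ∂P with hρ
  choose t ht using fun n : ℕ => floor_mem_Icc hb (Nat.cast_nonneg (α := ℝ) n)
  let F : ℕ → ℤ → Set ℝ := fun n j => D ∩ (fun y : ℝ => ⌊y * n⌋) ⁻¹' {j}
  have hF : ∀ n j, MeasurableSet (F n j) := fun n j =>
    hD.inter ((Int.measurable_floor.comp (measurable_id.mul_const _)) (measurableSet_singleton j))
  have hFD : ∀ n j, F n j ⊆ D := fun n j => Set.inter_subset_left
  have hFb : ∀ n j, Bornology.IsBounded (F n j) := fun n j => hb.subset (hFD n j)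
  have hFs : ∀ n j, Sided s (F n j) := fun n j => hs.mono (hFD n j)
  have hFdisj : ∀ n j l, j ≠ l → Disjoint (F n j) (F n l) := fun n j l hjl =>
    Set.disjoint_left.2 fun y hy hy' => hjl (hy.2.symm.trans hy'.2)
  have hcount : ∀ n X, (count D X : ℝ) = ∑ j ∈ t n, (count (F n j) X : ℝ) := fun n X => by
    exact_mod_cast count_eq_sum_fiber X hb (fun y : ℝ => ⌊y * n⌋) (t n) (ht n)
  -- The correlation formula covers disjoint sets only. Once the cells separate the finitely many
  -- points of `X` in `D`, each cell count is 0 or 1, hence its own square, and `U n X` equals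
  -- `count D X ^ 2`.
  let U : ℕ → Conf → ℝ := fun n X =>
    count D X + ∑ p ∈ (t n).offDiag, (count (F n p.1) X : ℝ) * count (F n p.2) X
  have hU0 : ∀ n X, 0 ≤ U n X := fun n X => by positivity
  have hUlim : ∀ X, ∀ᶠ n in atTop, U n X = (count D X : ℝ) ^ 2 := by
    intro X
    have hfin := finite_inter X hb
    have hev : ∀ᶠ n : ℕ in atTop, ∀ x ∈ X.carrier ∩ D, ∀ y ∈ X.carrier ∩ D, x ≠ y →
        ⌊x * n⌋ ≠ ⌊y * n⌋ := by
      rw [eventually_all_finite hfin]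
      intro x _
      rw [eventually_all_finite hfin]
      intro y _
      by_cases hxy : x = y
      · exact Eventually.of_forall fun n h => (h hxy).elim
      · filter_upwards [eventually_floor_ne hxy] with n hn _ using hn
    filter_upwards [hev] with n hn
    have hone : ∀ j, count (F n j) X ≤ 1 := by
      intro j
      refine (Set.ncard_le_one (finite_inter X (hFb n j))).2 ?_
      rintro a ⟨ha, haD, haj⟩ b ⟨hb, hbD, hbj⟩
      by_contra hab
      exact hn a ⟨ha, haD⟩ b ⟨hb, hbD⟩ hab (haj.trans hbj.symm)
    have hsq : ∀ j, (count (F n j) X : ℝ) * count (F n j) X = count (F n j) X := by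
      intro j
      have := hone j
      interval_cases count (F n j) X <;> simp
    have hdiagsum : ∑ p ∈ (t n).diag, (count (F n p.1) X : ℝ) * count (F n p.2) X =
        count D X := by
      rw [Finset.sum_diag, hcount n X]
      exact Finset.sum_congr rfl fun j _ => hsq j
    simp only [U]
    rw [← hdiagsum, ← Finset.sum_union (Finset.disjoint_diag_offDiag _), Finset.diag_union_offDiag,
      hdiagsum, sq, hcount n X, Finset.sum_mul_sum, Finset.sum_product]
  have hint2 : ∀ n, ∀ p ∈ (t n).offDiag,
      Integrable (fun X => (count (F n p.1) X : ℝ) * count (F n p.2) X) P ∧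
      ∫ X, (count (F n p.1) X : ℝ) * count (F n p.2) X ∂P =
        (∫ X, (count (F n p.1) X : ℝ) ∂P) * (∫ X, (count (F n p.2) X : ℝ) ∂P)
          - energy K (F n p.1) (F n p.2) := by
    intro n p hp
    have h := integral_count_mul hK hdiag hT hP (hF n p.1) (hFb n p.1) (hFs n p.1) (hF n p.2)
      (hFb n p.2) (hFs n p.2) (hFdisj n _ _ (Finset.mem_offDiag.1 hp).2.2)
    have hss : s * s = 1 := by rw [← sq, hs.sq_eq_one]
    rwa [hss, one_mul] at h
  have hUint : ∀ n, Integrable (U n) P := fun n =>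
    (integral_count hP hD hb).1.add (integrable_finsetSum _ fun p hp => (hint2 n p hp).1)
  have henergy : ∀ n : ℕ, ∑ p ∈ (t n).offDiag, energy K (F n p.1) (F n p.2) =
      ∫ p in D ×ˢ D ∩ {p | ⌊p.1 * n⌋ ≠ ⌊p.2 * n⌋}, ‖K p.1 p.2‖ ^ 2 := by
    intro n
    have hset : D ×ˢ D ∩ {p : ℝ × ℝ | ⌊p.1 * n⌋ ≠ ⌊p.2 * n⌋} =
        ⋃ q ∈ (t n).offDiag, F n q.1 ×ˢ F n q.2 := by
      ext ⟨x, y⟩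
      simp only [Set.mem_inter_iff, Set.mem_prod, Set.mem_ofPred_eq, Set.mem_iUnion, F,
        Set.mem_preimage, Set.mem_singleton_iff, Finset.mem_offDiag, exists_prop, Prod.exists]
      constructor
      · rintro ⟨⟨hx, hy⟩, hxy⟩
        exact ⟨_, _, ⟨ht n x hx, ht n y hy, hxy⟩, ⟨hx, rfl⟩, hy, rfl⟩
      · rintro ⟨a, b, ⟨-, -, hab⟩, ⟨hx, rfl⟩, hy, rfl⟩
        exact ⟨⟨hx, hy⟩, hab⟩
    rw [hset, integral_biUnion_finset]
    · rfl
    · exact fun q _ => (hF n q.1).prod (hF n q.2)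
    · intro q _ q' _ hqq
      refine Set.disjoint_left.2 ?_
      rintro ⟨x, y⟩ ⟨hx, hy⟩ ⟨hx', hy'⟩
      exact hqq (Prod.ext (hx.2.symm.trans hx'.2) (hy.2.symm.trans hy'.2))
    · exact fun q _ => integrableOn_kernel_sq hK hdiag hT (hF n q.2) (hFb n q.2) (hFs n q.2)
  have hUle : ∀ n : ℕ, ∫ X, U n X ∂P ≤
      ρ + ρ ^ 2 - ∫ p in D ×ˢ D ∩ {p | ⌊p.1 * n⌋ ≠ ⌊p.2 * n⌋}, ‖K p.1 p.2‖ ^ 2 := by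
    intro n
    have hρsum : ρ = ∑ j ∈ t n, ∫ X, (count (F n j) X : ℝ) ∂P := by
      rw [← integral_finsetSum _ fun j _ => (integral_count hP (hF n j) (hFb n j)).1, hρ]
      exact integral_congr_ae (Eventually.of_forall fun X => hcount n X)
    have hoff : ∑ p ∈ (t n).offDiag,
        (∫ X, (count (F n p.1) X : ℝ) ∂P) * (∫ X, (count (F n p.2) X : ℝ) ∂P) ≤ ρ ^ 2 := by
      rw [sq, hρsum, Finset.sum_mul_sum, ← Finset.sum_product']
      refine Finset.sum_le_sum_of_subset_of_nonneg ?_ fun p _ _ => ?_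
      · intro p hp
        rw [Finset.mem_offDiag] at hp
        exact Finset.mem_product.2 ⟨hp.1, hp.2.1⟩
      · exact mul_nonneg (integral_nonneg fun X => by positivity)
          (integral_nonneg fun X => by positivity)
    simp only [U]
    rw [integral_add (integral_count hP hD hb).1
      (integrable_finsetSum _ fun p hp => (hint2 n p hp).1),
      integral_finsetSum _ fun p hp => (hint2 n p hp).1,
      Finset.sum_congr rfl fun p hp => (hint2 n p hp).2, Finset.sum_sub_distrib, henergy]
    linarith
  have hlim : Tendsto (fun n : ℕ => ρ + ρ ^ 2 -
      ∫ p in D ×ˢ D ∩ {p | ⌊p.1 * n⌋ ≠ ⌊p.2 * n⌋}, ‖K p.1 p.2‖ ^ 2) atTop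
      (nhds (ρ + ρ ^ 2 - energy K D D)) :=
    tendsto_const_nhds.sub (tendsto_energy_offDiag hK hdiag hT hD hb hs)
  have hnn : 0 ≤ ρ + ρ ^ 2 - energy K D D :=
    ge_of_tendsto' hlim fun n => (integral_nonneg (hU0 n)).trans (hUle n)
  have hcm : Measurable fun X => (count D X : ℝ) :=
    (measurable_from_top (f := fun n : ℕ => (n : ℝ))).comp (measurable_count hD hb)
  -- Fatou gives only an inequality, but it also yields square integrability, and an upper bound for
  -- the variance suffices.
  have hfatou : ∫⁻ X, ENNReal.ofReal ((count D X : ℝ) ^ 2) ∂P ≤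
      ENNReal.ofReal (ρ + ρ ^ 2 - energy K D D) := by
    calc ∫⁻ X, ENNReal.ofReal ((count D X : ℝ) ^ 2) ∂P
        = ∫⁻ X, liminf (fun n => ENNReal.ofReal (U n X)) atTop ∂P := by
          refine lintegral_congr fun X => (Tendsto.liminf_eq ?_).symm
          refine tendsto_const_nhds.congr' ?_
          filter_upwards [hUlim X] with n hn
          rw [hn]
      _ ≤ liminf (fun n => ∫⁻ X, ENNReal.ofReal (U n X) ∂P) atTop :=
          lintegral_liminf_le' fun n => (hUint n).aemeasurable.ennreal_ofReal
      _ ≤ liminf (fun n : ℕ => ENNReal.ofReal (ρ + ρ ^ 2 -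
            ∫ p in D ×ˢ D ∩ {p | ⌊p.1 * n⌋ ≠ ⌊p.2 * n⌋}, ‖K p.1 p.2‖ ^ 2)) atTop := by
          refine liminf_le_liminf (Eventually.of_forall fun n => ?_)
          rw [← ofReal_integral_eq_lintegral_ofReal (hUint n) (Eventually.of_forall (hU0 n))]
          exact ENNReal.ofReal_le_ofReal (hUle n)
      _ = _ := ((ENNReal.continuous_ofReal.tendsto _).comp hlim).liminf_eq
  have hsqint : Integrable (fun X => (count D X : ℝ) ^ 2) P := by
    refine ⟨(hcm.pow_const 2).aestronglyMeasurable, ?_⟩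
    rw [hasFiniteIntegral_iff_ofReal (Eventually.of_forall fun X => by positivity)]
    exact hfatou.trans_lt ENNReal.ofReal_lt_top
  refine ⟨hsqint, ?_⟩
  rw [← ofReal_integral_eq_lintegral_ofReal hsqint
    (Eventually.of_forall fun X => by positivity)] at hfatou
  exact (ENNReal.ofReal_le_ofReal_iff hnn).1 hfatou

end

/-! ### A quadratic form on finitely supported functions -/

/-- The bilinear form `∑ᵢⱼ hᵢ gⱼ Mᵢⱼ` on finitely supported functions. -/
noncomputable def form (M : ℤ → ℤ → ℝ) : (ℤ →₀ ℝ) →ₗ[ℝ] (ℤ →₀ ℝ) →ₗ[ℝ] ℝ :=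
  Finsupp.linearCombination ℝ fun i => Finsupp.linearCombination ℝ (M i)

lemma form_apply (M : ℤ → ℤ → ℝ) (h g : ℤ →₀ ℝ) :
    form M h g = ∑ i ∈ h.support, h i * ∑ j ∈ g.support, g j * M i j := by
  simp [form, Finsupp.linearCombination_apply, Finsupp.sum, LinearMap.sum_apply]

lemma form_symm {M : ℤ → ℤ → ℝ} (hM : ∀ i j, M i j = M j i) (h g : ℤ →₀ ℝ) :
    form M h g = form M g h := by
  simp only [form_apply, Finset.mul_sum]
  rw [Finset.sum_comm]
  refine Finset.sum_congr rfl fun i _ => Finset.sum_congr rfl fun j _ => ?_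
  rw [hM j i]; ring

/-- A bounded, asymptotically orthogonal sequence has averages of arbitrarily small energy. -/
lemma exists_form_le {M : ℤ → ℤ → ℝ} (hM : ∀ i j, M i j = M j i) {g : ℕ → ℤ →₀ ℝ} {C : ℝ}
    (hC : ∀ᶠ R in atTop, form M (g R) (g R) ≤ C)
    (hlim : ∀ h, Tendsto (fun R => form M h (g R)) atTop (nhds 0))
    {S : Set (ℤ →₀ ℝ)} (hS : Convex ℝ S) (hg : ∀ᶠ R in atTop, g R ∈ S) (n : ℕ) :
    ∃ h ∈ S, (n + 1) * form M h h ≤ C + 1 := by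
  induction n with
  | zero =>
    obtain ⟨R, hR, hRS⟩ := (hC.and hg).exists
    exact ⟨g R, hRS, by simp; linarith⟩
  | succ n ih =>
    obtain ⟨h, hhS, hh⟩ := ih
    -- With the weights `(n+1)/(n+2)` and `1/(n+2)` below, the cross term enters multiplied by
    -- `2(n+1)`, so this tolerance makes it at most 1 and closes the induction: `((n+1)(C+1) + 1 +
    -- C)/(n+2) = C + 1`.
    have hsmall : ∀ᶠ R in atTop, form M h (g R) ≤ 1 / (2 * (n + 1)) :=
      (hlim h).eventually_le_const (by positivity)
    obtain ⟨R, ⟨hR, hRS⟩, hRh⟩ := ((hC.and hg).and hsmall).exists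
    have hn : (0 : ℝ) < n + 2 := by positivity
    refine ⟨((n + 1 : ℝ) / (n + 2)) • h + ((1 : ℝ) / (n + 2)) • g R,
      hS hhS hRS (by positivity) (by positivity) (by field_simp; ring), ?_⟩
    rw [le_div_iff₀ (by positivity)] at hRh
    simp only [map_add, map_smul, LinearMap.add_apply, LinearMap.smul_apply, smul_eq_mul,
      form_symm hM (g R) h]
    push_cast
    have e : ((n : ℝ) + 1 + 1) * ((n + 1) / (n + 2) * ((n + 1) / (n + 2) * form M h h) +
        1 / (n + 2) * ((n + 1) / (n + 2) * form M h (g R)) +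
        ((n + 1) / (n + 2) * (1 / (n + 2) * form M h (g R)) +
          1 / (n + 2) * (1 / (n + 2) * form M (g R) (g R)))) =
        ((n + 1) * ((n + 1) * form M h h) + form M h (g R) * (2 * (n + 1)) +
          form M (g R) (g R)) / (n + 2) := by
      field_simp
      ring
    have hmul : (n + 1 : ℝ) * ((n + 1) * form M h h) ≤ (n + 1) * (C + 1) := by gcongr
    refine le_trans (le_of_eq ?_) (show ((n + 1) * ((n + 1) * form M h h) +
      form M h (g R) * (2 * (n + 1)) + form M (g R) (g R)) / (n + 2) ≤ C + 1 from ?_)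
    · rw [← e]; ring
    · rw [div_le_iff₀ hn]; linarith

/-! ### The Dirichlet form of summable conductances. -/

section

variable {A : ℤ → ℤ → ℝ} {r : ℤ → ℝ}

/-- The Laplacian of the conductances `A` with row sums `r`. -/
def laplacian (A : ℤ → ℤ → ℝ) (r : ℤ → ℝ) (i j : ℤ) : ℝ := (if i = j then r i else 0) - A i j

lemma laplacian_symm (hA : ∀ i j, A i j = A j i) (i j : ℤ) :
    laplacian A r i j = laplacian A r j i := by
  rcases eq_or_ne i j with rfl | h
  · rfl
  · simp [laplacian, h, h.symm, hA i j]

lemma sum_laplacian (g : ℤ →₀ ℝ) (i : ℤ) :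
    ∑ j ∈ g.support, g j * laplacian A r i j = g i * r i - ∑ j ∈ g.support, g j * A i j := by
  simp only [laplacian, mul_sub, Finset.sum_sub_distrib, mul_ite, mul_zero, Finset.sum_ite_eq]
  congr 1
  split_ifs with h
  · rfl
  · simp [Finsupp.notMem_support_iff.1 h]

/-- Each row of the Laplacian annihilates constants, and dominated convergence with the summable
bound `A i` lets `g R → 1` pass through the row. -/
lemma tendsto_form_laplacian (hA0 : ∀ i j, 0 ≤ A i j) (hr : ∀ i, HasSum (A i) (r i))
    {g : ℕ → ℤ →₀ ℝ} (hg1 : ∀ R i, |g R i| ≤ 1) (hg : ∀ i, ∀ᶠ R in atTop, g R i = 1)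
    (h : ℤ →₀ ℝ) : Tendsto (fun R => form (laplacian A r) h (g R)) atTop (nhds 0) := by
  simp only [form_apply, sum_laplacian]
  have key : ∀ i, Tendsto (fun R => g R i * r i - ∑ j ∈ (g R).support, g R j * A i j) atTop
      (nhds 0) := by
    intro i
    have hone : ∀ j, Tendsto (fun R => g R j) atTop (nhds 1) := fun j =>
      tendsto_const_nhds.congr' ((hg j).mono fun R hR => hR.symm)
    have h2 : Tendsto (fun R => ∑' j, g R j * A i j) atTop (nhds (∑' j, 1 * A i j)) := by
      refine tendsto_tsum_of_dominated_convergence (bound := A i) (hr i).summable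
        (fun j => (hone j).mul_const _) (Eventually.of_forall fun R j => ?_)
      rw [Real.norm_eq_abs, abs_mul, abs_of_nonneg (hA0 i j)]
      exact mul_le_of_le_one_left (hA0 i j) (hg1 R j)
    have h3 : ∀ R, ∑' j, g R j * A i j = ∑ j ∈ (g R).support, g R j * A i j := fun R =>
      tsum_eq_sum fun j hj => by simp [Finsupp.notMem_support_iff.1 hj]
    simp only [h3, one_mul, (hr i).tsum_eq] at h2
    simpa using ((hone i).mul_const (r i)).sub h2
  simpa using tendsto_finsetSum h.support fun i _ => (key i).const_mul (h i)

/-- Expand the square: row sums absorb the two pure squares. The factor 2 comes from summing over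
ordered pairs. -/
lemma hasSum_form_laplacian (hA : ∀ i j, A i j = A j i) (hr : ∀ i, HasSum (A i) (r i))
    (g : ℤ →₀ ℝ) :
    HasSum (fun p : ℤ × ℤ => (g p.1 - g p.2) ^ 2 * A p.1 p.2)
      (2 * form (laplacian A r) g g) := by
  classical
  have h1 : HasSum (fun p : ℤ × ℤ => g p.1 ^ 2 * A p.1 p.2) (∑ i ∈ g.support, g i ^ 2 * r i) := by
    have hi : ∀ i ∈ g.support, HasSum (fun p : ℤ × ℤ => if p.1 = i then g i ^ 2 * A i p.2 else 0)
        (g i ^ 2 * r i) := by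
      intro i _
      rw [← (Prod.mk_right_injective i).hasSum_iff]
      · simpa [Function.comp_def] using (hr i).mul_left (g i ^ 2)
      · rintro ⟨a, b⟩ hab
        rw [if_neg]
        rintro rfl
        exact hab ⟨b, rfl⟩
    refine (hasSum_sum hi).congr_fun fun p => ?_
    rw [Finset.sum_ite_eq]
    split_ifs with h
    · rfl
    · simp [Finsupp.notMem_support_iff.1 h]
  have h2 : HasSum (fun p : ℤ × ℤ => g p.2 ^ 2 * A p.1 p.2) (∑ i ∈ g.support, g i ^ 2 * r i) := by
    have := (Equiv.prodComm ℤ ℤ).hasSum_iff.2 h1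
    refine this.congr_fun fun p => ?_
    simp [hA p.1 p.2]
  have h3 : HasSum (fun p : ℤ × ℤ => g p.1 * g p.2 * A p.1 p.2)
      (∑ p ∈ g.support ×ˢ g.support, g p.1 * g p.2 * A p.1 p.2) := by
    refine hasSum_sum_of_ne_finset_zero fun p hp => ?_
    rw [Finset.mem_product, not_and_or] at hp
    rcases hp with hp | hp <;> simp [Finsupp.notMem_support_iff.1 hp]
  have h4 := (h1.add h2).sub (h3.mul_left 2)
  have e : 2 * form (laplacian A r) g g =
      ∑ i ∈ g.support, g i ^ 2 * r i + ∑ i ∈ g.support, g i ^ 2 * r i -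
        2 * ∑ p ∈ g.support ×ˢ g.support, g p.1 * g p.2 * A p.1 p.2 := by
    have e1 : ∑ i ∈ g.support, g i * (g i * r i) = ∑ i ∈ g.support, g i ^ 2 * r i :=
      Finset.sum_congr rfl fun i _ => by ring
    have e2 : ∑ i ∈ g.support, g i * ∑ j ∈ g.support, g j * A i j =
        ∑ p ∈ g.support ×ˢ g.support, g p.1 * g p.2 * A p.1 p.2 := by
      rw [Finset.sum_product]
      refine Finset.sum_congr rfl fun i _ => ?_
      rw [Finset.mul_sum]
      exact Finset.sum_congr rfl fun j _ => by ring
    simp only [form_apply, sum_laplacian, mul_sub, Finset.sum_sub_distrib]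
    rw [e1, e2]
    ring
  rw [e]
  exact h4.congr_fun fun p => by ring

/-! ### Trapezoidal cut-offs and their energy. -/

/-- The trapezoidal cut-off: `1` on `[-R, R]`, `0` off `[-2R, 2R]`, linear in between. -/
noncomputable def cutoff (R : ℕ) : ℤ →₀ ℝ :=
  Finsupp.onFinset (Finset.Icc (-2 * R : ℤ) (2 * R))
    (fun i => if i ∈ Finset.Icc (-2 * R : ℤ) (2 * R) then max 0 (min 1 (2 - |(i : ℝ)| / R)) else 0)
    (fun i hi => by by_contra h; exact hi (if_neg h))

lemma cutoff_apply {R : ℕ} (hR : 1 ≤ R) (i : ℤ) :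
    cutoff R i = max 0 (min 1 (2 - |(i : ℝ)| / R)) := by
  have hR' : (0 : ℝ) < R := by exact_mod_cast hR
  simp only [cutoff, Finsupp.onFinset_apply]
  split_ifs with h
  · rfl
  · have : (2 * R : ℝ) < |(i : ℝ)| := by
      rw [lt_abs]
      rw [Finset.mem_Icc, not_and_or, not_le, not_le] at h
      rcases h with h | h
      · right; have : (i : ℝ) < -2 * R := by exact_mod_cast h
        linarith
      · left; exact_mod_cast h
    have h2 : 2 - |(i : ℝ)| / R ≤ 0 := by
      rw [sub_nonpos, le_div_iff₀ hR']; exact this.le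
    rw [max_eq_left ((min_le_right _ _).trans h2)]

lemma cutoff_eq_one {R : ℕ} {i : ℤ} (hR : 1 ≤ R) (h : |(i : ℝ)| ≤ R) : cutoff R i = 1 := by
  have hR' : (0 : ℝ) < R := by exact_mod_cast hR
  have : |(i : ℝ)| / R ≤ 1 := (div_le_one hR').2 h
  rw [cutoff_apply hR, min_eq_left (by linarith), max_eq_right zero_le_one]

lemma cutoff_eq_zero {R : ℕ} {i : ℤ} (h : i ∉ Finset.Icc (-2 * R : ℤ) (2 * R)) :
    cutoff R i = 0 := by
  simp only [cutoff, Finsupp.onFinset_apply, if_neg h]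

lemma cutoff_mem_Icc (R : ℕ) (i : ℤ) : cutoff R i ∈ Set.Icc (0 : ℝ) 1 := by
  simp only [cutoff, Finsupp.onFinset_apply]
  split_ifs
  · exact ⟨le_max_left _ _, max_le zero_le_one (min_le_left _ _)⟩
  · simp

lemma abs_cutoff_sub_le {R : ℕ} (hR : 1 ≤ R) (i j : ℤ) :
    |cutoff R i - cutoff R j| ≤ |(i : ℝ) - j| / R := by
  have hR' : (0 : ℝ) < R := by exact_mod_cast hR
  rw [cutoff_apply hR, cutoff_apply hR]
  refine (abs_max_sub_max_le_max _ _ _ _).trans ?_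
  rw [sub_self, abs_zero, max_eq_right (abs_nonneg _)]
  refine (abs_min_sub_min_le_max _ _ _ _).trans ?_
  rw [sub_self, abs_zero, max_eq_right (abs_nonneg _)]
  have : 2 - |(i : ℝ)| / R - (2 - |(j : ℝ)| / R) = (|(j : ℝ)| - |(i : ℝ)|) / R := by ring
  rw [this, abs_div, abs_of_pos hR']
  refine div_le_div_of_nonneg_right ?_ hR'.le
  rw [abs_sub_comm (i : ℝ)]
  exact abs_abs_sub_abs_le _ _

/-- A discrete layer-cake bound: the difference is at most `min(R, |i-j|)/R`, and `m² = ∑_{k<m}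
(2k+1)`. It reduces the energy to the tails of `A i` over `|i-j| > k`. -/
lemma cutoff_sub_sq_le {R : ℕ} (hR : 1 ≤ R) (i j : ℤ) :
    (cutoff R i - cutoff R j) ^ 2 ≤
      ∑ k ∈ Finset.range R, if k < (i - j).natAbs then (2 * (k : ℝ) + 1) / R ^ 2 else 0 := by
  have hR' : (0 : ℝ) < R := by exact_mod_cast hR
  have hsum : ∀ n : ℕ, ∑ k ∈ Finset.range n, (2 * (k : ℝ) + 1) = (n : ℝ) ^ 2 := by
    intro n
    induction n with
    | zero => simp
    | succ n ih => rw [Finset.sum_range_succ, ih]; push_cast; ring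
  have e : ∑ k ∈ Finset.range R, (if k < (i - j).natAbs then (2 * (k : ℝ) + 1) / R ^ 2 else 0) =
      ((min R (i - j).natAbs : ℕ) : ℝ) ^ 2 / R ^ 2 := by
    have hf : (Finset.range R).filter (fun k => k < (i - j).natAbs) =
        Finset.range (min R (i - j).natAbs) := by
      ext k; simp
    rw [← Finset.sum_filter, ← Finset.sum_div, hf, hsum]
  rw [e, ← div_pow, ← sq_abs]
  have h1 := abs_cutoff_sub_le hR i j
  have h2 : |cutoff R i - cutoff R j| ≤ 1 := by
    have hi := cutoff_mem_Icc R i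
    have hj := cutoff_mem_Icc R j
    rw [abs_le]; constructor <;> linarith [hi.1, hi.2, hj.1, hj.2]
  have h3 : (((i - j).natAbs : ℕ) : ℝ) = |(i : ℝ) - j| := by
    rw [Nat.cast_natAbs]; push_cast; rfl
  gcongr
  rcases le_total R (i - j).natAbs with h | h
  · rw [min_eq_left h, div_self hR'.ne']; exact h2
  · rw [min_eq_right h, h3]; exact h1

/-- If the conductances have tails `O(1/k)` outside a finite set, the cut-offs have bounded
energy. -/
lemma form_cutoff_le (hA0 : ∀ i j, 0 ≤ A i j) (hA : ∀ i j, A i j = A j i)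
    (hr : ∀ i, HasSum (A i) (r i)) (F : Finset ℤ) {C : ℝ} (hC : 0 ≤ C)
    (htail : ∀ i ∉ F, ∀ k : ℕ, ∑' j, (if j ∉ F ∧ k < (i - j).natAbs then
      ENNReal.ofReal (A i j) else 0) ≤ ENNReal.ofReal (C / (k + 1))) {R : ℕ} (hR : 1 ≤ R) :
    form (laplacian A r) (cutoff R) (cutoff R) ≤ ∑ i ∈ F, r i + 10 * C := by
  classical
  have hR' : (0 : ℝ) < R := by exact_mod_cast hR
  have hr0 : ∀ i, 0 ≤ r i := fun i => (hr i).nonneg (hA0 i)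
  set W := Finset.Icc (-2 * R : ℤ) (2 * R) with hW
  set Q := form (laplacian A r) (cutoff R) (cutoff R) with hQ
  have hsum := hasSum_form_laplacian hA hr (cutoff R)
  rw [← hQ] at hsum
  -- `u` takes the pairs meeting `F`, where the squared difference is bounded by 1; `v` takes the
  -- pairs off `F`. The difference vanishes unless an index lies in `W`, so by symmetry that index
  -- may be put first.
  let u : ℤ → ℤ → ℝ≥0∞ := fun i j => if i ∈ F then ENNReal.ofReal (A i j) else 0
  let v : ℤ → ℤ → ℝ≥0∞ := fun i j => if i ∉ F ∧ j ∉ F ∧ i ∈ W then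
    ENNReal.ofReal ((cutoff R i - cutoff R j) ^ 2 * A i j) else 0
  have hpt : ∀ i j, ENNReal.ofReal ((cutoff R i - cutoff R j) ^ 2 * A i j) ≤
      (u i j + u j i) + (v i j + v j i) := by
    intro i j
    have hle1 : (cutoff R i - cutoff R j) ^ 2 * A i j ≤ A i j := by
      refine mul_le_of_le_one_left (hA0 i j) ?_
      have hi := cutoff_mem_Icc R i
      have hj := cutoff_mem_Icc R j
      rw [sq_le_one_iff_abs_le_one, abs_le]
      constructor <;> linarith [hi.1, hi.2, hj.1, hj.2]
    by_cases hi : i ∈ F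
    · refine le_trans ?_ (le_add_right (le_add_right (le_refl (u i j))))
      simp only [u, if_pos hi]
      exact ENNReal.ofReal_le_ofReal hle1
    by_cases hj : j ∈ F
    · refine le_trans ?_ (le_add_right (le_add_left (le_refl (u j i))))
      simp only [u, if_pos hj]
      rw [hA j i]
      exact ENNReal.ofReal_le_ofReal hle1
    by_cases hiW : i ∈ W
    · refine le_trans ?_ (le_add_left (le_add_right (le_refl (v i j))))
      simp only [v, hi, hj, hiW, not_false_eq_true, and_self, if_true, le_refl]
    by_cases hjW : j ∈ W
    · refine le_trans ?_ (le_add_left (le_add_left (le_refl (v j i))))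
      simp only [v, hi, hj, hjW, not_false_eq_true, and_self, if_true]
      rw [hA j i, ← neg_sub (cutoff R j), neg_sq]
    · rw [cutoff_eq_zero hiW, cutoff_eq_zero hjW]; simp
  have hu : ∑' i, ∑' j, u i j = ENNReal.ofReal (∑ i ∈ F, r i) := by
    rw [ENNReal.ofReal_sum_of_nonneg fun i _ => hr0 i, tsum_eq_sum (s := F)]
    · refine Finset.sum_congr rfl fun i hi => ?_
      simp only [u, if_pos hi]
      rw [← ENNReal.ofReal_tsum_of_nonneg (hA0 i) (hr i).summable, (hr i).tsum_eq]
    · intro i hi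
      simp [u, hi]
  have hvrow : ∀ i, ∑' j, v i j ≤ if i ∈ W then ENNReal.ofReal (2 * C / R) else 0 := by
    intro i
    by_cases hi : i ∉ F ∧ i ∈ W
    swap
    · have : ∀ j, v i j = 0 := fun j => if_neg fun h => hi ⟨h.1, h.2.2⟩
      simp [this]
    rw [if_pos hi.2]
    have hv : ∀ j, v i j ≤ ∑ k ∈ Finset.range R, ENNReal.ofReal ((2 * (k : ℝ) + 1) / R ^ 2) *
        (if j ∉ F ∧ k < (i - j).natAbs then ENNReal.ofReal (A i j) else 0) := by
      intro j
      by_cases hj : j ∈ F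
      · simp [v, hj]
      simp only [v, hi.1, hi.2, hj, not_false_eq_true, and_self, if_true, true_and]
      refine (ENNReal.ofReal_le_ofReal
        (mul_le_mul_of_nonneg_right (cutoff_sub_sq_le hR i j) (hA0 i j))).trans ?_
      rw [Finset.sum_mul, ENNReal.ofReal_sum_of_nonneg]
      · refine Finset.sum_le_sum fun k _ => ?_
        split_ifs
        · rw [ENNReal.ofReal_mul (by positivity)]
        · simp
      · intro k _
        split_ifs
        · exact mul_nonneg (by positivity) (hA0 i j)
        · simp
    calc ∑' j, v i j ≤ ∑' j, ∑ k ∈ Finset.range R, ENNReal.ofReal ((2 * (k : ℝ) + 1) / R ^ 2) *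
          (if j ∉ F ∧ k < (i - j).natAbs then ENNReal.ofReal (A i j) else 0) :=
          ENNReal.tsum_le_tsum hv
      _ = ∑ k ∈ Finset.range R, ENNReal.ofReal ((2 * (k : ℝ) + 1) / R ^ 2) *
          ∑' j, (if j ∉ F ∧ k < (i - j).natAbs then ENNReal.ofReal (A i j) else 0) := by
          rw [Summable.tsum_finsetSum fun k _ => ENNReal.summable]
          simp_rw [ENNReal.tsum_mul_left]
      _ ≤ ∑ k ∈ Finset.range R, ENNReal.ofReal (2 * C / R ^ 2) := by
          refine Finset.sum_le_sum fun k _ => ?_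
          refine (mul_le_mul_right (htail i hi.1 k) _).trans ?_
          rw [← ENNReal.ofReal_mul (by positivity)]
          refine ENNReal.ofReal_le_ofReal ?_
          -- Since `(2k+1)/(k+1) ≤ 2`, every layer costs at most `2C/R²`; the `R` layers give `2C/R`
          -- per row, and the at most `5R` rows of `W` give `10C`.
          rw [div_mul_div_comm, div_le_div_iff₀ (by positivity) (by positivity)]
          have : 0 ≤ C * (R : ℝ) ^ 2 := by positivity
          nlinarith
      _ = ENNReal.ofReal (2 * C / R) := by
          rw [Finset.sum_const, Finset.card_range, nsmul_eq_mul, ← ENNReal.ofReal_natCast,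
            ← ENNReal.ofReal_mul (by positivity)]
          congr 1
          field_simp
  have hv : ∑' i, ∑' j, v i j ≤ ENNReal.ofReal (10 * C) := by
    refine (ENNReal.tsum_le_tsum hvrow).trans ?_
    rw [tsum_eq_sum (s := W) fun i hi => if_neg hi]
    rw [Finset.sum_congr rfl fun i hi => if_pos hi, Finset.sum_const, nsmul_eq_mul,
      ← ENNReal.ofReal_natCast, ← ENNReal.ofReal_mul (by positivity)]
    refine ENNReal.ofReal_le_ofReal ?_
    have hcard : (W.card : ℝ) ≤ 5 * R := by
      rw [hW, Int.card_Icc]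
      have : (2 * (R : ℤ) + 1 - -2 * R).toNat ≤ 5 * R := by omega
      exact_mod_cast this
    calc (W.card : ℝ) * (2 * C / R) ≤ 5 * R * (2 * C / R) := by gcongr
      _ = 10 * C := by field_simp; ring
  have hfinal : ENNReal.ofReal (2 * Q) ≤ ENNReal.ofReal (2 * (∑ i ∈ F, r i + 10 * C)) := by
    rw [← hsum.tsum_eq, ENNReal.ofReal_tsum_of_nonneg
      (fun p => mul_nonneg (sq_nonneg _) (hA0 _ _)) hsum.summable]
    rw [ENNReal.tsum_prod (f := fun i j =>
      ENNReal.ofReal ((cutoff R i - cutoff R j) ^ 2 * A i j))]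
    refine (ENNReal.tsum_le_tsum fun i => ENNReal.tsum_le_tsum fun j => hpt i j).trans ?_
    simp_rw [ENNReal.tsum_add]
    rw [ENNReal.tsum_comm (f := fun i j => u j i), ENNReal.tsum_comm (f := fun i j => v j i), hu]
    have hF0 : 0 ≤ ∑ i ∈ F, r i := Finset.sum_nonneg fun i _ => hr0 i
    refine (add_le_add le_rfl (add_le_add hv hv)).trans (le_of_eq ?_)
    rw [← ENNReal.ofReal_add hF0 hF0, ← ENNReal.ofReal_add (by positivity) (by positivity),
      ← ENNReal.ofReal_add (by positivity) (by positivity)]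
    congr 1; ring
  have hF0 : 0 ≤ ∑ i ∈ F, r i := Finset.sum_nonneg fun i _ => hr0 i
  have := (ENNReal.ofReal_le_ofReal_iff (by positivity)).1 hfinal
  linarith

end

/-! ### Unit cells -/

/-- The points other than `0` with integer part `i`. -/
def unitCell (i : ℤ) : Set ℝ := (fun x : ℝ => ⌊x⌋) ⁻¹' {i} ∩ {0}ᶜ

/-- The sign of the points of `unitCell i`. -/
def cellSign (i : ℤ) : ℝ := if 0 ≤ i then 1 else -1

lemma cellSign_mul_self (i : ℤ) : cellSign i * cellSign i = 1 := by
  unfold cellSign; split_ifs <;> norm_num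

lemma measurableSet_unitCell (i : ℤ) : MeasurableSet (unitCell i) :=
  (Int.measurable_floor (measurableSet_singleton i)).inter (measurableSet_singleton 0).compl

lemma unitCell_subset (i : ℤ) : unitCell i ⊆ Set.Icc (i : ℝ) (i + 1) := by
  rintro x ⟨hx, -⟩
  have := Int.floor_eq_iff.1 hx
  exact ⟨this.1, this.2.le⟩

lemma isBounded_unitCell (i : ℤ) : Bornology.IsBounded (unitCell i) :=
  (Metric.isBounded_Icc _ _).subset (unitCell_subset i)

lemma volume_unitCell_le (i : ℤ) : volume (unitCell i) ≤ 1 := by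
  refine (measure_mono (unitCell_subset i)).trans (le_of_eq ?_)
  simp

lemma pairwise_disjoint_unitCell : Pairwise (Function.onFun Disjoint unitCell) := fun _ _ hij =>
  Set.disjoint_left.2 fun _ hi hj => hij (hi.1.symm.trans hj.1)

lemma iUnion_unitCell : ⋃ i, unitCell i = {0}ᶜ := by
  ext x
  exact ⟨fun hx => (Set.mem_iUnion.1 hx).choose_spec.2, fun hx => Set.mem_iUnion.2 ⟨⌊x⌋, rfl, hx⟩⟩

/-- The origin, where the sign vanishes, has been removed from cell 0; all other cells miss it. -/
lemma sided_unitCell (i : ℤ) : Sided (cellSign i) (unitCell i) := by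
  refine ⟨by rw [sq, cellSign_mul_self], fun x hx => ?_⟩
  unfold cellSign
  split_ifs with h
  · refine Real.sign_of_pos (lt_of_le_of_ne ?_ (Ne.symm hx.2))
    rw [← (show ⌊x⌋ = i from hx.1)] at h
    exact Int.floor_nonneg.1 h
  · refine Real.sign_of_neg ?_
    rw [← (show ⌊x⌋ = i from hx.1), Int.floor_nonneg] at h
    exact not_le.1 h

section

variable {K : ℝ → ℝ → ℂ} {T : L2 →L[ℂ] L2} {P : Measure Conf}

/-- `∫∫ |K|²` over a pair of unit cells. -/
noncomputable def cellEnergy (K : ℝ → ℝ → ℂ) (i j : ℤ) : ℝ := energy K (unitCell i) (unitCell j)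

/-- The expected number of points in a unit cell. -/
noncomputable def cellMean (P : Measure Conf) (i : ℤ) : ℝ := ∫ X, (count (unitCell i) X : ℝ) ∂P

lemma cellEnergy_nonneg (i j : ℤ) : 0 ≤ cellEnergy K i j :=
  integral_nonneg fun _ => by positivity

lemma cellEnergy_symm (hK : IsJHermitianKernel K T) (i j : ℤ) :
    cellEnergy K i j = cellEnergy K j i := by
  unfold cellEnergy energy
  rw [Measure.volume_eq_prod, ← setIntegral_prod_swap]
  refine setIntegral_congr_fun ((measurableSet_unitCell j).prod (measurableSet_unitCell i))
    fun p hp => ?_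
  simp only [Prod.fst_swap, Prod.snd_swap]
  rw [hK.norm_symm hp.2.2 hp.1.2]

/-- The projection property in discrete form: the cells exhaust the line up to a null set, so the
row sum is the full Hilbert–Schmidt norm over one cell, which is its mean count. -/
lemma hasSum_cellEnergy (hK : IsJHermitianKernel K T) (hdiag : IsTraceDiagonal K T)
    (hT : IsStarProjection (hat T)) (hP : IsDeterminantal K P) (i : ℤ) :
    HasSum (cellEnergy K i) (cellMean P i) := by
  have h0 : 0 ≤ cellMean P i := integral_nonneg fun X => by positivity
  have hre : (∫ x in unitCell i, K x x).re = cellMean P i := by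
    rw [← (integral_count hP (measurableSet_unitCell i) (isBounded_unitCell i)).2,
      Complex.ofReal_re]; rfl
  have hsum : ∑' j, ENNReal.ofReal (cellEnergy K i j) = ENNReal.ofReal (cellMean P i) := by
    simp_rw [cellEnergy_symm hK i]
    unfold cellEnergy
    simp_rw [ofReal_energy hK hdiag hT (measurableSet_unitCell i) (isBounded_unitCell i)
      (sided_unitCell i)]
    rw [← lintegral_iUnion measurableSet_unitCell pairwise_disjoint_unitCell, iUnion_unitCell,
      ← hre, ← lintegral_kernel_sq hK.toIsIntegralKernel hdiag hT (measurableSet_unitCell i)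
        (isBounded_unitCell i) (sided_unitCell i).subset_or]
    have hae : ({0}ᶜ : Set ℝ) =ᵐ[volume] Set.univ := by
      rw [ae_eq_univ, compl_compl]
      exact Real.volume_singleton
    rw [setLIntegral_congr hae, setLIntegral_univ]
  have h := ENNReal.hasSum_toReal (f := fun j => ENNReal.ofReal (cellEnergy K i j))
    (by rw [hsum]; exact ENNReal.ofReal_ne_top)
  rw [← ENNReal.tsum_toReal_eq fun _ => ENNReal.ofReal_ne_top, hsum,
    ENNReal.toReal_ofReal h0] at h
  simpa only [ENNReal.toReal_ofReal (cellEnergy_nonneg i _)] using h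

/-- Replacing `k` by `k + 1` in the denominator makes one constant serve for all `k`, including `k =
0`. -/
lemma exists_tail_bound {Φ : ℝ → ℝ} (h0 : ∀ t, 0 ≤ Φ t)
    (hO : (fun R : ℝ => ∫ t in {t | R ≤ |t|}, Φ t) =O[atTop] (fun R : ℝ => R⁻¹)) :
    ∃ C : ℝ, 0 ≤ C ∧ ∀ k : ℕ, ∫ t in {t | (k : ℝ) ≤ |t|}, Φ t ≤ C / (k + 1) := by
  have h1 : (fun k : ℕ => ∫ t in {t | (k : ℝ) ≤ |t|}, Φ t) =O[atTop] fun k : ℕ => ((k : ℝ))⁻¹ :=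
    hO.comp_tendsto tendsto_natCast_atTop_atTop
  have h2 : (fun k : ℕ => ((k : ℝ))⁻¹) =O[atTop] fun k : ℕ => ((k : ℝ) + 1)⁻¹ := by
    refine IsBigO.of_bound 2 ?_
    filter_upwards [eventually_ge_atTop 1] with k hk
    have hk' : (1 : ℝ) ≤ k := by exact_mod_cast hk
    rw [norm_inv, norm_inv, Real.norm_of_nonneg (by positivity), Real.norm_of_nonneg (by positivity),
      ← div_eq_mul_inv, inv_eq_one_div, div_le_div_iff₀ (by positivity) (by positivity)]
    linarith
  obtain ⟨C, hC, hb⟩ := bound_of_isBigO_nat_atTop (h1.trans h2)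
  refine ⟨C, hC.le, fun k => ?_⟩
  have := hb (x := k) (by positivity)
  rw [Real.norm_of_nonneg (integral_nonneg h0), Real.norm_of_nonneg (by positivity)] at this
  rwa [div_eq_mul_inv]

/-- `F` collects the cells near the origin where the decay hypothesis is silent. Off `F`,
`|K(x,y)|²` is dominated by `Φ(x-y)`, whose tail bounds each row uniformly in `x`. -/
lemma exists_cellEnergy_tail (hK : IsJHermitianKernel K T) (hdiag : IsTraceDiagonal K T)
    (hT : IsStarProjection (hat T)) {M : ℝ} (h2 : Condition2 K M) :
    ∃ (F : Finset ℤ) (C : ℝ), 0 ≤ C ∧ ∀ i ∉ F, ∀ k : ℕ,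
      ∑' j, (if j ∉ F ∧ k < (i - j).natAbs then ENNReal.ofReal (cellEnergy K i j) else 0) ≤
        ENNReal.ofReal (C / (k + 1)) := by
  obtain ⟨Φ, hΦ0, hΦi, hΦO, hΦ⟩ := h2.decay
  obtain ⟨C, hC0, hC⟩ := exists_tail_bound hΦ0 hΦO
  obtain ⟨m, hm⟩ := exists_nat_ge M
  let F : Finset ℤ := Finset.Icc (-m - 1 : ℤ) m
  have hF : ∀ i ∉ F, ∀ x ∈ unitCell i, M ≤ |x| := by
    intro i hi x hx
    have hfl := Int.floor_eq_iff.1 hx.1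
    simp only [F, Finset.mem_Icc, not_and_or, not_le] at hi
    refine hm.trans (le_abs.2 ?_)
    rcases hi with hi | hi
    · right
      have : (i : ℝ) + 1 ≤ -m - 1 := by exact_mod_cast hi
      linarith [hfl.2]
    · left
      have : (m : ℝ) < i := by exact_mod_cast hi
      linarith [hfl.1]
  refine ⟨F, C, hC0, fun i hi k => ?_⟩
  let Jk : Set ℤ := {j | j ∉ F ∧ k < (i - j).natAbs}
  have hmK : Measurable fun p : ℝ × ℝ => ‖K p.1 p.2‖ₑ ^ 2 := hK.measurable.enorm.pow_const 2
  have hrow : ∀ x ∈ unitCell i, ∑' j, Jk.indicator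
      (fun j => ∫⁻ y in unitCell j, ‖K x y‖ₑ ^ 2) j ≤ ENNReal.ofReal (C / (k + 1)) := by
    intro x hx
    rw [← tsum_subtype, ← lintegral_iUnion (fun j : Jk => measurableSet_unitCell j)
      (fun a b hab => pairwise_disjoint_unitCell (Subtype.coe_injective.ne hab))]
    -- Index distance at least `k + 1` leaves point distance at least `k`, one unit being lost to
    -- the width of the cells.
    have hset : ∀ y ∈ ⋃ j : Jk, unitCell j, (k : ℝ) ≤ |x - y| ∧ M ≤ |y| := by
      intro y hy
      obtain ⟨⟨j, hj⟩, hyj⟩ := Set.mem_iUnion.1 hy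
      refine ⟨?_, hF j hj.1 y hyj⟩
      have hx' := Int.floor_eq_iff.1 hx.1
      have hy' := Int.floor_eq_iff.1 hyj.1
      have hk := hj.2
      refine le_abs.2 ?_
      rcases le_total j i with hle | hle
      · left
        have : (k : ℤ) + 1 ≤ i - j := by omega
        have : (k : ℝ) + 1 ≤ i - j := by exact_mod_cast this
        linarith [hx'.1, hy'.2]
      · right
        have : (k : ℤ) + 1 ≤ j - i := by omega
        have : (k : ℝ) + 1 ≤ j - i := by exact_mod_cast this
        linarith [hx'.2, hy'.1]
    have hms : MeasurableSet {t : ℝ | (k : ℝ) ≤ |t|} :=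
      measurableSet_le measurable_const continuous_abs.measurable
    calc ∫⁻ y in ⋃ j : Jk, unitCell j, ‖K x y‖ₑ ^ 2
        ≤ ∫⁻ y, {t : ℝ | (k : ℝ) ≤ |t|}.indicator (fun t => ENNReal.ofReal (Φ t)) (x - y) := by
          rw [← lintegral_indicator (MeasurableSet.iUnion fun j : Jk => measurableSet_unitCell j)]
          refine lintegral_mono fun y => ?_
          by_cases hy : y ∈ ⋃ j : Jk, unitCell j
          · rw [Set.indicator_of_mem hy, Set.indicator_of_mem
              (show x - y ∈ {t : ℝ | (k : ℝ) ≤ |t|} from (hset y hy).1), ← ofReal_norm,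
              ← ENNReal.ofReal_pow (norm_nonneg _)]
            exact ENNReal.ofReal_le_ofReal (hΦ x y (hF i hi x hx) (hset y hy).2)
          · rw [Set.indicator_of_notMem hy]; exact zero_le
      _ = ∫⁻ t in {t : ℝ | (k : ℝ) ≤ |t|}, ENNReal.ofReal (Φ t) := by
          rw [lintegral_sub_left_eq_self, lintegral_indicator hms]
      _ = ENNReal.ofReal (∫ t in {t : ℝ | (k : ℝ) ≤ |t|}, Φ t) :=
          (ofReal_integral_eq_lintegral_ofReal hΦi.integrableOn
            (Eventually.of_forall hΦ0)).symm
      _ ≤ _ := ENNReal.ofReal_le_ofReal (hC k)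
  calc ∑' j, (if j ∉ F ∧ k < (i - j).natAbs then ENNReal.ofReal (cellEnergy K i j) else 0)
      = ∑' j, ∫⁻ x in unitCell i, Jk.indicator (fun j => ∫⁻ y in unitCell j, ‖K x y‖ₑ ^ 2) j := by
        refine tsum_congr fun j => ?_
        by_cases hj : j ∈ Jk
        · rw [if_pos (show j ∉ F ∧ k < (i - j).natAbs from hj)]
          simp only [Set.indicator_of_mem hj]
          exact ofReal_energy hK hdiag hT (measurableSet_unitCell j) (isBounded_unitCell j)
            (sided_unitCell j)
        · rw [if_neg (show ¬(j ∉ F ∧ k < (i - j).natAbs) from hj)]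
          simp only [Set.indicator_of_notMem hj, lintegral_zero]
    _ = ∫⁻ x in unitCell i, ∑' j, Jk.indicator (fun j => ∫⁻ y in unitCell j, ‖K x y‖ₑ ^ 2) j := by
        rw [lintegral_tsum]
        intro j
        by_cases hj : j ∈ Jk
        · simp only [Set.indicator_of_mem hj]
          exact hmK.lintegral_prod_right'.aemeasurable
        · simp only [Set.indicator_of_notMem hj]
          exact aemeasurable_const
    _ ≤ ∫⁻ x in unitCell i, ENNReal.ofReal (C / (k + 1)) :=
        setLIntegral_mono measurable_const hrow
    _ ≤ ENNReal.ofReal (C / (k + 1)) := by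
        rw [setLIntegral_const]
        exact mul_le_of_le_one_right' (volume_unitCell_le i)

/-! ### Signed linear statistics -/

/-- The linear statistic `∑_{x ∈ X} sgn(x) h(⌊x⌋)`. -/
noncomputable def signedStat (h : ℤ →₀ ℝ) (X : Conf) : ℝ :=
  ∑ i ∈ h.support, h i * cellSign i * count (unitCell i) X

lemma measurable_signedStat (h : ℤ →₀ ℝ) : Measurable (signedStat h) :=
  Finset.measurable_sum _ fun i _ => ((measurable_from_top (f := fun n : ℕ => (n : ℝ))).comp
    (measurable_count (measurableSet_unitCell i) (isBounded_unitCell i))).const_mul _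

/-- The variance of a signed linear statistic is at most its energy. -/
lemma variance_signedStat_le (hK : IsJHermitianKernel K T) (hdiag : IsTraceDiagonal K T)
    (hT : IsStarProjection (hat T)) (hP : IsDeterminantal K P) (h : ℤ →₀ ℝ) :
    Integrable (fun X => (signedStat h X - ∫ Y, signedStat h Y ∂P) ^ 2) P ∧
      ∫ X, (signedStat h X - ∫ Y, signedStat h Y ∂P) ^ 2 ∂P ≤
        form (laplacian (cellEnergy K) (cellMean P)) h h := by
  have := hP.isProbabilityMeasure
  let c : ℤ → ℝ := fun i => h i * cellSign i
  have hN : ∀ i, Integrable (fun X => (count (unitCell i) X : ℝ)) P := fun i =>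
    (integral_count hP (measurableSet_unitCell i) (isBounded_unitCell i)).1
  have hpair : ∀ i j, Integrable
      (fun X => (c i * count (unitCell i) X) * (c j * count (unitCell j) X)) P ∧
      ∫ X, (c i * count (unitCell i) X) * (c j * count (unitCell j) X) ∂P ≤
        (c i * cellMean P i) * (c j * cellMean P j) +
          h i * (h j * laplacian (cellEnergy K) (cellMean P) i j) := by
    intro i j
    have e : (fun X => (c i * count (unitCell i) X) * (c j * count (unitCell j) X)) =
        fun X => (c i * c j) * ((count (unitCell i) X : ℝ) * count (unitCell j) X) := by
      ext X; ring
    rw [e, integral_const_mul]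
    rcases eq_or_ne i j with rfl | hij
    · obtain ⟨h1, h2⟩ := integral_count_sq_le hK hdiag hT hP (measurableSet_unitCell i)
        (isBounded_unitCell i) (sided_unitCell i)
      simp only [sq] at h1 h2
      refine ⟨h1.const_mul _, ?_⟩
      have hcc : c i * c i = h i * h i := by
        simp only [c]; linear_combination (h i * h i) * cellSign_mul_self i
      refine (mul_le_mul_of_nonneg_left h2 (mul_self_nonneg (c i))).trans (le_of_eq ?_)
      simp only [laplacian, if_true, cellEnergy, cellMean]
      linear_combination ((∫ X, (count (unitCell i) X : ℝ) ∂P) -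
        energy K (unitCell i) (unitCell i)) * hcc
    · obtain ⟨h1, h2⟩ := integral_count_mul hK hdiag hT hP (measurableSet_unitCell i)
        (isBounded_unitCell i) (sided_unitCell i) (measurableSet_unitCell j)
        (isBounded_unitCell j) (sided_unitCell j) (pairwise_disjoint_unitCell hij)
      refine ⟨h1.const_mul _, le_of_eq ?_⟩
      rw [h2]
      -- The signs of the statistic cancel those of the two-point function, so all off-diagonal
      -- entries become `-A i j`, as a Laplacian requires.
      have hcc : c i * c j * (cellSign i * cellSign j) = h i * h j := by
        simp only [c]
        linear_combination (h i * h j * (cellSign j * cellSign j)) * cellSign_mul_self i +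
          (h i * h j) * cellSign_mul_self j
      simp only [laplacian, if_neg hij, cellEnergy, cellMean]
      linear_combination -energy K (unitCell i) (unitCell j) * hcc
  have hS : Integrable (signedStat h) P := integrable_finsetSum _ fun i _ => (hN i).const_mul _
  have hmean : ∫ Y, signedStat h Y ∂P = ∑ i ∈ h.support, c i * cellMean P i := by
    unfold signedStat
    rw [integral_finsetSum _ fun i _ => (hN i).const_mul _]
    exact Finset.sum_congr rfl fun i _ => integral_const_mul _ _
  have hsq : ∀ X, signedStat h X ^ 2 = ∑ i ∈ h.support, ∑ j ∈ h.support,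
      (c i * count (unitCell i) X) * (c j * count (unitCell j) X) := fun X => by
    rw [sq, signedStat, Finset.sum_mul_sum]
  have hSS : Integrable (fun X => signedStat h X ^ 2) P := by
    simp_rw [hsq]
    exact integrable_finsetSum _ fun i _ => integrable_finsetSum _ fun j _ => (hpair i j).1
  have hSSle : ∫ X, signedStat h X ^ 2 ∂P ≤ (∫ Y, signedStat h Y ∂P) ^ 2 +
      form (laplacian (cellEnergy K) (cellMean P)) h h := by
    simp_rw [hsq]
    rw [integral_finsetSum _ fun i _ => integrable_finsetSum _ fun j _ => (hpair i j).1,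
      hmean, sq, Finset.sum_mul_sum, form_apply, ← Finset.sum_add_distrib]
    refine Finset.sum_le_sum fun i _ => ?_
    rw [integral_finsetSum _ fun j _ => (hpair i j).1, Finset.mul_sum, ← Finset.sum_add_distrib]
    exact Finset.sum_le_sum fun j _ => (hpair i j).2
  set m := ∫ Y, signedStat h Y ∂P with hm
  have e : (fun X => (signedStat h X - m) ^ 2) =
      fun X => signedStat h X ^ 2 - (2 * m) * signedStat h X + m ^ 2 := by
    ext X; ring
  have hi1 : Integrable (fun X => signedStat h X ^ 2 - (2 * m) * signedStat h X) P :=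
    hSS.sub (hS.const_mul _)
  rw [e]
  refine ⟨hi1.add (integrable_const _), ?_⟩
  rw [integral_add hi1 (integrable_const _), integral_sub hSS (hS.const_mul _),
    integral_const_mul, ← hm]
  simp only [integral_const, probReal_univ, one_smul]
  linarith

lemma count_eq_count_diff_add (X : Conf) (B : Set ℝ) {I : Set ℝ} (hI : Bornology.IsBounded I) :
    count I X = count I (X.diff B) + count (I ∩ B) X := by
  unfold count
  rw [← Set.ncard_union_eq _ ((finite_inter (X.diff B) hI))
    (finite_inter X (hI.subset Set.inter_subset_left))]
  · congr 1
    ext x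
    simp only [Conf.diff, Set.mem_inter_iff, Set.mem_union, Set.mem_sdiff]
    tauto
  · refine Set.disjoint_left.2 ?_
    rintro x ⟨⟨-, hx⟩, -⟩ ⟨-, -, hx'⟩
    exact hx hx'

/-- If `h = 1` on the cells meeting `B`, the points in `B` contribute to the linear statistic
the difference of the numbers of positive and negative points in `B`. -/
lemma signedStat_eq (X : Conf) {B : Set ℝ} (hB : Bornology.IsBounded B) {W : Finset ℤ}
    (hW : ∀ y ∈ B, ⌊y⌋ ∈ W) {h : ℤ →₀ ℝ} (hh : ∀ i ∈ W, h i = 1) :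
    signedStat h X = signedStat h (X.diff B) +
      ((count (B ∩ Set.Ioi 0) X : ℝ) - count (B ∩ Set.Iio 0) X) := by
  have hWs : ∀ y ∈ B, ⌊y⌋ ∈ h.support := fun y hy => by
    rw [Finsupp.mem_support_iff, hh _ (hW y hy)]; exact one_ne_zero
  rw [count_eq_sum_fiber X (hB.subset Set.inter_subset_left) (fun y : ℝ => ⌊y⌋) h.support
      (fun y hy => hWs y hy.1),
    count_eq_sum_fiber X (hB.subset Set.inter_subset_left) (fun y : ℝ => ⌊y⌋) h.support
      (fun y hy => hWs y hy.1)]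
  push_cast
  unfold signedStat
  rw [← Finset.sum_sub_distrib, ← Finset.sum_add_distrib]
  refine Finset.sum_congr rfl fun i _ => ?_
  rw [count_eq_count_diff_add X B (isBounded_unitCell i)]
  push_cast
  rw [mul_add]
  congr 1
  by_cases hi : i ∈ W
  · rw [hh i hi, one_mul]
    rcases le_or_gt 0 i with h0 | h0
    · have e1 : B ∩ Set.Ioi 0 ∩ (fun y : ℝ => ⌊y⌋) ⁻¹' {i} = unitCell i ∩ B := by
        ext x
        simp only [unitCell, Set.mem_inter_iff, Set.mem_Ioi, Set.mem_preimage,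
          Set.mem_singleton_iff, Set.mem_compl_iff]
        constructor
        · rintro ⟨⟨hxB, hx⟩, hf⟩
          exact ⟨⟨hf, hx.ne'⟩, hxB⟩
        · rintro ⟨⟨hf, hx⟩, hxB⟩
          refine ⟨⟨hxB, lt_of_le_of_ne ?_ (Ne.symm hx)⟩, hf⟩
          rw [← hf] at h0
          exact Int.floor_nonneg.1 h0
      have e2 : B ∩ Set.Iio 0 ∩ (fun y : ℝ => ⌊y⌋) ⁻¹' {i} = ∅ := by
        refine Set.eq_empty_of_forall_notMem ?_
        rintro x ⟨⟨-, hx⟩, hf⟩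
        have hf' : ⌊x⌋ = i := hf
        rw [← hf', Int.floor_nonneg] at h0
        exact absurd hx (not_lt.2 h0)
      rw [e1, e2]
      simp [cellSign, h0, count]
    · have e1 : B ∩ Set.Iio 0 ∩ (fun y : ℝ => ⌊y⌋) ⁻¹' {i} = unitCell i ∩ B := by
        ext x
        simp only [unitCell, Set.mem_inter_iff, Set.mem_Iio, Set.mem_preimage,
          Set.mem_singleton_iff, Set.mem_compl_iff]
        constructor
        · rintro ⟨⟨hxB, hx⟩, hf⟩
          exact ⟨⟨hf, hx.ne⟩, hxB⟩
        · rintro ⟨⟨hf, hx⟩, hxB⟩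
          refine ⟨⟨hxB, ?_⟩, hf⟩
          by_contra hx0
          rw [← hf] at h0
          exact absurd (Int.floor_nonneg.2 (not_lt.1 hx0)) (not_le.2 h0)
      have e2 : B ∩ Set.Ioi 0 ∩ (fun y : ℝ => ⌊y⌋) ⁻¹' {i} = ∅ := by
        refine Set.eq_empty_of_forall_notMem ?_
        rintro x ⟨⟨-, hx⟩, hf⟩
        have hf' : ⌊x⌋ = i := hf
        rw [← hf'] at h0
        exact absurd (Int.floor_nonneg.2 (le_of_lt hx)) (not_le.2 h0)
      rw [e1, e2]
      simp [cellSign, not_le.2 h0, count]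
  -- Outside `W` the weight is arbitrary, but such a cell does not meet `B`.
  · have e : ∀ s : Set ℝ, (∀ x ∈ s, x ∈ B ∧ ⌊x⌋ = i) → count s X = 0 := by
      intro s hs
      have : s = ∅ := Set.eq_empty_of_forall_notMem fun x hx => hi ((hs x hx).2 ▸ hW x (hs x hx).1)
      simp [this, count]
    rw [e (unitCell i ∩ B) fun x hx => ⟨hx.2, hx.1.1⟩,
      e (B ∩ Set.Ioi 0 ∩ (fun y : ℝ => ⌊y⌋) ⁻¹' {i}) fun x hx => ⟨hx.1.1, hx.2⟩,
      e (B ∩ Set.Iio 0 ∩ (fun y : ℝ => ⌊y⌋) ⁻¹' {i}) fun x hx => ⟨hx.1.1, hx.2⟩]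
    simp

/-- There are cut-offs, equal to `1` on a given finite set, of arbitrarily small energy. -/
lemma exists_form_laplacian_le (hK : IsJHermitianKernel K T) (hdiag : IsTraceDiagonal K T)
    (hT : IsStarProjection (hat T)) (hP : IsDeterminantal K P) {M : ℝ} (h2 : Condition2 K M)
    (W : Finset ℤ) {ε : ℝ} (hε : 0 < ε) :
    ∃ h : ℤ →₀ ℝ, (∀ i ∈ W, h i = 1) ∧
      form (laplacian (cellEnergy K) (cellMean P)) h h ≤ ε := by
  obtain ⟨F, C, hC, htail⟩ := exists_cellEnergy_tail hK hdiag hT h2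
  have hr := hasSum_cellEnergy hK hdiag hT hP
  have hone : ∀ i : ℤ, ∀ᶠ R : ℕ in atTop, cutoff R i = 1 := fun i => by
    filter_upwards [eventually_ge_atTop 1,
      (tendsto_natCast_atTop_atTop (R := ℝ)).eventually_ge_atTop |(i : ℝ)|] with R hR hRi
    exact cutoff_eq_one hR hRi
  -- Convexity keeps the constraint under the averaging of cut-offs.
  have hconv : Convex ℝ {h : ℤ →₀ ℝ | ∀ i ∈ W, h i = 1} := by
    intro h hh g hg a b _ _ hab i hi
    simp [hh i hi, hg i hi, hab]
  set C' := ∑ i ∈ F, cellMean P i + 10 * C with hC'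
  obtain ⟨n, hn⟩ := exists_nat_ge ((C' + 1) / ε)
  obtain ⟨h, hh, hle⟩ := exists_form_le (laplacian_symm (cellEnergy_symm hK)) (C := C')
    ((eventually_ge_atTop 1).mono fun R hR =>
      form_cutoff_le cellEnergy_nonneg (cellEnergy_symm hK) hr F hC htail hR)
    (tendsto_form_laplacian cellEnergy_nonneg hr (fun R i => by
      have := cutoff_mem_Icc R i
      rw [abs_of_nonneg this.1]; exact this.2) hone)
    hconv ((eventually_all_finset W).2 fun i _ => hone i) n
  refine ⟨h, hh, ?_⟩
  rw [div_le_iff₀ hε] at hn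
  have hpos : (0 : ℝ) < n + 1 := by positivity
  refine le_of_mul_le_mul_left (hle.trans ?_) hpos
  nlinarith

/-- Centred square integrable functions with summable second moments tend to `0` almost surely. -/
lemma ae_tendsto_zero_of_summable {f : ℕ → Conf → ℝ} (hf : ∀ n, Integrable (fun X => f n X ^ 2) P)
    {ε : ℕ → ℝ} (hε : Summable ε) (hε0 : ∀ n, 0 ≤ ε n) (hle : ∀ n, ∫ X, f n X ^ 2 ∂P ≤ ε n) :
    ∀ᵐ X ∂P, Tendsto (fun n => f n X) atTop (nhds 0) := by
  have hm : ∀ n, AEMeasurable (fun X => ENNReal.ofReal (f n X ^ 2)) P := fun n =>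
    (hf n).aemeasurable.ennreal_ofReal
  have hfin : ∫⁻ X, ∑' n, ENNReal.ofReal (f n X ^ 2) ∂P ≠ ∞ := by
    rw [lintegral_tsum hm]
    refine ne_top_of_le_ne_top ?_ (ENNReal.tsum_le_tsum fun n => ?_) (b := ∑' n, ENNReal.ofReal (ε n))
    · rw [← ENNReal.ofReal_tsum_of_nonneg hε0 hε]; exact ENNReal.ofReal_ne_top
    · rw [← ofReal_integral_eq_lintegral_ofReal (hf n)
        (Eventually.of_forall fun X => sq_nonneg _)]
      exact ENNReal.ofReal_le_ofReal (hle n)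
  filter_upwards [ae_lt_top' (AEMeasurable.tsum hm) hfin] with X hX
  have h1 := ENNReal.tendsto_atTop_zero_of_tsum_ne_top hX.ne
  have h2 := (ENNReal.tendsto_toReal ENNReal.zero_ne_top).comp h1
  simp only [Function.comp_def, ENNReal.toReal_ofReal (sq_nonneg _), ENNReal.toReal_zero] at h2
  have h3 := h2.sqrt
  simp only [Real.sqrt_sq_eq_abs, Real.sqrt_zero] at h3
  exact (tendsto_zero_iff_abs_tendsto_zero _).2 h3

end

end BalancedRigidity

/-! ### Rigidity of the balance. -/

open BalancedRigidity in
theorem mainTheorem4 (K : ℝ → ℝ → ℂ) (T : BalancedRigidity.L2 →L[ℂ] BalancedRigidity.L2)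
    (hK : BalancedRigidity.IsJHermitianKernel K T)
    (hdiag : BalancedRigidity.IsTraceDiagonal K T)
    (h1 : BalancedRigidity.Condition1 T)
    (M : ℝ) (hM : 0 < M) (h2 : BalancedRigidity.Condition2 K M)
    (P : MeasureTheory.Measure BalancedRigidity.Conf)
    (hP : BalancedRigidity.IsDeterminantal K P)
    (B : Set ℝ) (hB : MeasurableSet B) (hBb : Bornology.IsBounded B) :
    ∃ N : BalancedRigidity.Conf → ℤ, Measurable N ∧
      ∀ᵐ X ∂P, (BalancedRigidity.count (B ∩ Set.Ioi 0) X : ℤ)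
        - (BalancedRigidity.count (B ∩ Set.Iio 0) X : ℤ) = N (X.diff B) := by
  obtain ⟨W, hW⟩ := floor_mem_Icc hBb zero_le_one
  simp only [mul_one] at hW
  choose h hh1 hhle using fun n : ℕ => exists_form_laplacian_le hK hdiag h1.projection hP h2 W
    (ε := (1 / 2 : ℝ) ^ n) (by positivity)
  let m : ℕ → ℝ := fun n => ∫ Y, signedStat (h n) Y ∂P
  have hae : ∀ᵐ X ∂P, Tendsto (fun n => signedStat (h n) X - m n) atTop (nhds 0) :=
    ae_tendsto_zero_of_summable
      (fun n => (variance_signedStat_le hK hdiag h1.projection hP (h n)).1)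
      summable_geometric_two (fun n => by positivity)
      (fun n => (variance_signedStat_le hK hdiag h1.projection hP (h n)).2.trans (hhle n))
  -- The `limsup` is defined and measurable for every configuration, whether or not the sequence
  -- converges. For almost every `X` it is a limit at `X ∖ B` with an integer value, which the floor
  -- returns.
  refine ⟨fun Y => ⌊limsup (fun n => m n - signedStat (h n) Y) atTop⌋,
    Int.measurable_floor.comp (Measurable.limsup fun n =>
      measurable_const.sub (measurable_signedStat (h n))), ?_⟩
  filter_upwards [hae] with X hX
  have hlim : Tendsto (fun n => m n - signedStat (h n) (X.diff B)) atTop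
      (nhds ((count (B ∩ Set.Ioi 0) X : ℝ) - count (B ∩ Set.Iio 0) X)) := by
    have h3 := (tendsto_const_nhds (x := (count (B ∩ Set.Ioi 0) X : ℝ)
      - count (B ∩ Set.Iio 0) X)).sub hX
    rw [sub_zero] at h3
    refine h3.congr fun n => ?_
    rw [signedStat_eq X hBb hW (hh1 n)]
    ring
  rw [hlim.limsup_eq]
  symm
  exact_mod_cast Int.floor_intCast (R := ℝ)
    ((count (B ∩ Set.Ioi 0) X : ℤ) - (count (B ∩ Set.Iio 0) X : ℤ))
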